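/- Let $I\subseteq\mathbb R$ be an open interval with $0\in I$. Consider the one-dimensional Gross–Pitaevskii equation $$ i\,\partial_t q+\partial_{xx}q-2(|q|^2-1)q=0,\qquad q=q(t,x)\in\mathbb C,\quad (t,x)\in I\times\mathbb R. \tag{GP}$$ Write $\dot H^1$ for the space of locally integrable $f:\mathbb R\to\mathbb C$ with weak derivative in $L^2(\mathbb R)$, with seminorm $\|f\|_{\dot H^1}=\|\partial_x f\|_{L^2(\mathbb R)}$, and write $L^\infty=L^\infty(\mathbb R;\mathbb C)$, $L^2_{\mathrm{loc}}=L^2_{\mathrm{loc}}(\mathbb R;\mathbb C)$. Let $q_0\in L^\infty\cap\dot H^1$ and let $q_1,q_2\in C(I;L^2_{\mathrm{loc}})\cap L^\infty(I;L^\infty\cap\dot H^1)$; that is, for every compact $K\subset\mathbb R$ the map $t\mapsto q_j(t)|_K\in L^2(K)$ is continuous on $I$, and $\operatorname{ess\,sup}_{t\in I}\big(\|q_j(t)\|_{L^\infty}+\|q_j(t)\|_{\dot H^1}\big)<\infty$. Suppose that $q_1$ and $q_2$ both solve (GP) in the sense of distributions on $I\times\mathbb R$, i.e. for every $\varphi\in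 C_c^\infty(I\times\mathbb R;\mathbb C)$ $$\int_{I\times\mathbb R} q_j\,\big(-i\,\partial_t\varphi+\partial_{xx}\varphi\big)-2(|q_j|^2-1)\,q_j\,\varphi\;\mathrm d(t,x)=0,$$ and that $q_1(0)=q_2(0)=q_0$. Then $q_1=q_2$, i.e. for every $t\in I$, $q_1(t)=q_2(t)$ almost everywhere on $\mathbb R$. -/

import Mathlib

open MeasureTheory Filter Topology TopologicalSpace
open scoped ENNReal NNReal Distributions

noncomputable section

namespace GrossPitaevskii

/-- Measurable functions `ℝ → ℂ` modulo equality almost everywhere. -/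
abbrev Wave : Type := ℝ →ₘ[volume] ℂ

/-- `g` is the weak (distributional) derivative of `f` on `ℝ`. -/
def HasWeakDeriv (f g : Wave) : Prop :=
  LocallyIntegrable f volume ∧ LocallyIntegrable g volume ∧
    ∀ φ : 𝓓((⊤ : Opens ℝ), ℂ), ∫ x, f x * deriv φ x = - ∫ x, g x * φ x

/-- The homogeneous Sobolev seminorm `‖∂ₓ f‖_{L²}`, with value `∞` when `f` has no locally
integrable weak derivative. The weak derivative is unique, so the infimum is over at most one
element. -/
def hDotOneSeminorm (f : Wave) : ℝ≥0∞ :=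
  ⨅ (g : Wave) (_ : HasWeakDeriv f g), eLpNorm g 2 volume

/-- `f ∈ L^∞ ∩ Ḣ¹`. -/
def MemLinftyHDotOne (f : Wave) : Prop :=
  eLpNorm f ∞ volume < ∞ ∧ hDotOneSeminorm f < ∞

/-- `q ∈ C(I; L²_loc)`: the values are square integrable on compact sets, and `q` is continuous
for the seminorms `‖·‖_{L²(K)}`, `K` compact. -/
def ContinuousL2loc (I : Opens ℝ) (q : ℝ → Wave) : Prop :=
  ∀ K : Set ℝ, IsCompact K →
    (∀ t ∈ I, MemLp (q t) 2 (volume.restrict K)) ∧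
    ∀ t₀ ∈ I, Tendsto (fun t => eLpNorm (q t - q t₀ : Wave) 2 (volume.restrict K))
      (𝓝[(I : Set ℝ)] t₀) (𝓝 0)

/-- `q ∈ L^∞(I; L^∞ ∩ Ḣ¹)`: both norms of `q(t)` are essentially bounded in `t ∈ I`. -/
def BoundedLinftyHDotOne (I : Opens ℝ) (q : ℝ → Wave) : Prop :=
  ∃ M : ℝ≥0, ∀ᵐ t ∂(volume.restrict (I : Set ℝ)),
    eLpNorm (q t) ∞ volume ≤ M ∧ hDotOneSeminorm (q t) ≤ M

/-- The space-time domain `I × ℝ`, points written `(t, x)`. -/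
def slab (I : Opens ℝ) : Opens (ℝ × ℝ) :=
  ⟨(I : Set ℝ) ×ˢ Set.univ, I.isOpen.prod isOpen_univ⟩

/-- `u : ℝ × ℝ → ℂ`, a function of `(t, x)`, solves `i ∂ₜ u + ∂ₓₓ u - 2 (|u|² - 1) u = 0`
in the sense of distributions on `I × ℝ`. -/
def SolvesGPWeakly (I : Opens ℝ) (u : ℝ × ℝ → ℂ) : Prop :=
  LocallyIntegrableOn u (slab I : Set (ℝ × ℝ)) volume ∧
  LocallyIntegrableOn (fun p => 2 * ((‖u p‖ : ℂ) ^ 2 - 1) * u p)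
    (slab I : Set (ℝ × ℝ)) volume ∧
  ∀ φ : 𝓓(slab I, ℂ),
    ∫ p in (slab I : Set (ℝ × ℝ)),
      (u p * (- Complex.I * deriv (fun s => φ (s, p.2)) p.1
          + iteratedDeriv 2 (fun y => φ (p.1, y)) p.2)
        - 2 * ((‖u p‖ : ℂ) ^ 2 - 1) * u p * φ p) = 0

/-- The curve `t ↦ q(t)` is a distributional solution on `I × ℝ`: the function of `(t, x)` that
it defines (unique up to a null set of `I × ℝ`) solves the equation. -/
def IsDistributionalSolution (I : Opens ℝ) (q : ℝ → Wave) : Prop :=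
  ∃ u : ℝ × ℝ → ℂ,
    (∀ᵐ t ∂(volume.restrict (I : Set ℝ)), (fun x => u (t, x)) =ᵐ[volume] q t) ∧
    SolvesGPWeakly I u

end GrossPitaevskii

end

/-!
The difference `w` of two solutions satisfies `i ∂ₜ w + ∂ₓₓ w = f` with `|f| ≤ L |w|`, since both
solutions are bounded. It need not be square integrable, so its energy is localized by the weight
`ρ(x) = 1 / (1 + (δ x)²)`; and it is mollified to `v = φ ⋆ w` at scale `δ²`, to make the computation
classical. The only terms in the time derivative of `∫ ρ |v|²` that Gronwall's inequality does not
absorb are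

* the commutator `∫ ρ' ⟨v, i ∂ₓ v⟩`, which is `O(δ)` because `|ρ'| ≤ δ ρ` and `∂ₓ v ∈ L²`;
* the mollification error in `|φ ⋆ f| ≤ L (|v| + O(δ))`, where `w` is Hölder continuous of exponent
  `1/2` because `∂ₓ w ∈ L²`. Its square contributes `O(δ²) ∫ ρ = O(δ)`.

Hence `∫ ρ |w|² = O(δ)`, and `w = 0` on letting `δ → 0`.
-/

namespace GrossPitaevskii

open scoped ContDiff Convolution

section WeakDerivative

variable {E : Type*} [NormedAddCommGroup E] [NormedSpace ℝ E] {I : Opens ℝ}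

theorem exists_deriv_eq_of_integral_eq_zero (hI : (I : Set ℝ).OrdConnected) (ψ : 𝓓(I, ℝ))
    (h0 : ∫ x, ψ x = 0) : ∃ θ : 𝓓(I, ℝ), deriv θ = ψ := by
  rcases (tsupport ψ).eq_empty_or_nonempty with he | hne
  · exact ⟨0, funext fun x => by simp [tsupport_eq_empty_iff.1 he]⟩
  obtain ⟨a, ha, ha'⟩ := ψ.hasCompactSupport.isCompact.exists_isLeast hne
  obtain ⟨b, hb, hb'⟩ := ψ.hasCompactSupport.isCompact.exists_isGreatest hne
  have hzero : ∀ x, x < a ∨ b < x → ψ x = 0 := fun x hx =>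
    image_eq_zero_of_notMem_tsupport fun h => by
      rcases hx with hx | hx
      exacts [hx.not_ge (ha' h), hx.not_ge (hb' h)]
  set θ : ℝ → ℝ := fun x => ∫ t in Set.Iic x, ψ t
  have hθ : ∀ x, HasDerivAt θ (ψ x) x := fun x => by
    have hint : Integrable ψ := ψ.continuous.integrable_of_hasCompactSupport ψ.hasCompactSupport
    have hθ0 : θ = fun x => θ 0 + ∫ t in (0)..x, ψ t := funext fun y => by
      rw [← intervalIntegral.integral_Iic_sub_Iic hint.integrableOn hint.integrableOn]
      ring
    rw [hθ0]
    exact (ψ.continuous.integral_hasStrictDerivAt 0 x).hasDerivAt.const_add _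
  have hsupp : Function.support θ ⊆ Set.Icc a b := fun x hx => by
    by_contra! h
    rw [Set.mem_Icc, not_and_or, not_le, not_le] at h
    refine hx (h.elim (fun h => ?_) fun h => ?_)
    · exact setIntegral_eq_zero_of_forall_eq_zero fun t ht => hzero t (.inl (ht.trans_lt h))
    · rw [← h0]
      exact setIntegral_eq_integral_of_forall_compl_eq_zero fun t ht =>
        hzero t (.inr (h.trans (not_le.1 ht)))
  have hd : deriv θ = ψ := funext fun x => (hθ x).deriv
  refine ⟨⟨θ, ?_, .of_support_subset_isCompact isCompact_Icc hsupp,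
    (closure_minimal hsupp isClosed_Icc).trans
      (hI.out (ψ.tsupport_subset ha) (ψ.tsupport_subset hb))⟩, hd⟩
  exact contDiff_infty_iff_deriv.2 ⟨fun x => (hθ x).differentiableAt, hd ▸ ψ.contDiff⟩

theorem integrable_smul_of_tsupport_subset {g : ℝ → ℝ} {c : ℝ → E} (hg : Continuous g)
    (hgc : HasCompactSupport g) (hgI : tsupport g ⊆ I) (hc : ContinuousOn c I) :
    Integrable fun t => g t • c t :=
  ((hg.continuousOn.smul hc).continuous_of_tsupport_subset I.isOpen
    ((tsupport_smul_subset_left g c).trans hgI)).integrable_of_hasCompactSupport hgc.smul_right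

theorem integrable_testFunction_smul {c : ℝ → E} (θ : 𝓓(I, ℝ)) (hc : ContinuousOn c I) :
    Integrable fun t => θ t • c t :=
  integrable_smul_of_tsupport_subset θ.continuous θ.hasCompactSupport θ.tsupport_subset hc

theorem integrable_deriv_testFunction_smul {c : ℝ → E} (θ : 𝓓(I, ℝ)) (hc : ContinuousOn c I) :
    Integrable fun t => deriv θ t • c t :=
  integrable_smul_of_tsupport_subset (θ.contDiff.continuous_deriv (by simp))
    θ.hasCompactSupport.deriv (tsupport_deriv_subset.trans θ.tsupport_subset) hc

theorem exists_testFunction_integral_eq_one (hne : (I : Set ℝ).Nonempty) :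
    ∃ ψ : 𝓓(I, ℝ), ∫ t, ψ t = 1 := by
  obtain ⟨t₀, ht₀⟩ := hne
  obtain ⟨r, hr, hrI⟩ := Metric.isOpen_iff.1 I.isOpen t₀ ht₀
  let φ : ContDiffBump t₀ := ⟨r / 4, r / 2, by positivity, by linarith⟩
  refine ⟨⟨φ.normed volume, φ.contDiff_normed, φ.hasCompactSupport_normed, ?_⟩, φ.integral_normed⟩
  rw [φ.tsupport_normed_eq]
  exact (Metric.closedBall_subset_ball (half_lt_self hr)).trans hrI

theorem integral_deriv_smul_eq_neg {B b : ℝ → E} (hB : ∀ s ∈ I, HasDerivAt B (b s) s)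
    (hb : ContinuousOn b I) (θ : 𝓓(I, ℝ)) :
    ∫ s, deriv θ s • B s = - ∫ s, θ s • b s := by
  have hBc : ContinuousOn B I := fun s hs => (hB s hs).continuousAt.continuousWithinAt
  have hprod : ∀ s, HasDerivAt (fun s => θ s • B s) (θ s • b s + deriv θ s • B s) s := fun s => by
    by_cases hs : s ∈ I
    · exact (θ.contDiff.differentiable (by simp) s).hasDerivAt.smul (hB s hs)
    · have hθ : θ =ᶠ[𝓝 s] 0 :=
        notMem_tsupport_iff_eventuallyEq.1 fun h => hs (θ.tsupport_subset h)
      have h0 : (fun s => θ s • B s) =ᶠ[𝓝 s] fun _ => 0 := hθ.mono fun t ht => by simp [ht]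
      rw [hθ.deriv_eq, hθ.self_of_nhds]
      simpa using (hasDerivAt_const s (0 : E)).congr_of_eventuallyEq h0
  have hb' := integrable_testFunction_smul θ hb
  have hB' := integrable_deriv_testFunction_smul θ hBc
  have h0 := integral_eq_zero_of_hasDerivAt_of_integrable hprod (hb'.add hB')
    (integrable_testFunction_smul θ hBc)
  rw [integral_add hb' hB'] at h0
  exact eq_neg_of_add_eq_zero_right h0

variable [CompleteSpace E]

theorem eqOn_const_of_integral_deriv_smul_eq_zero (hI : (I : Set ℝ).OrdConnected) {c : ℝ → E}
    (hc : ContinuousOn c I) (hw : ∀ θ : 𝓓(I, ℝ), ∫ t, deriv θ t • c t = 0) :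
    ∃ κ : E, Set.EqOn c (fun _ => κ) I := by
  rcases (I : Set ℝ).eq_empty_or_nonempty with hI0 | hne
  · exact ⟨0, by simp [hI0]⟩
  obtain ⟨ψ, hψ⟩ := exists_testFunction_integral_eq_one hne
  have hint : ∀ θ : 𝓓(I, ℝ), Integrable θ := fun θ =>
    θ.continuous.integrable_of_hasCompactSupport θ.hasCompactSupport
  set κ := ∫ t, ψ t • c t
  have hκ : ∀ g : 𝓓(I, ℝ), ∫ t, g t • (c t - κ) = 0 := fun g => by
    obtain ⟨θ, hθ⟩ := exists_deriv_eq_of_integral_eq_zero hI (g - (∫ s, g s) • ψ) (by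
      simp only [FunLike.coe_sub, FunLike.coe_smul, Pi.sub_apply, Pi.smul_apply]
      rw [integral_sub (hint g) ((hint ψ).fun_smul _), integral_smul, hψ, smul_eq_mul, mul_one,
        sub_self])
    have hθ0 := hw θ
    simp only [hθ, FunLike.coe_sub, FunLike.coe_smul, Pi.sub_apply, Pi.smul_apply, sub_smul,
      smul_assoc] at hθ0
    rw [integral_sub (integrable_testFunction_smul g hc)
      ((integrable_testFunction_smul ψ hc).fun_smul _), integral_smul] at hθ0
    simp only [smul_sub]
    rwa [integral_sub (integrable_testFunction_smul g hc) ((hint g).smul_const κ),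
      integral_smul_const]
  have hae := I.isOpen.ae_eq_zero_of_integral_contDiff_smul_eq_zero
    ((hc.sub continuousOn_const).locallyIntegrableOn I.isOpen.measurableSet)
    fun g hg hgc hgI => hκ ⟨g, hg, hgc, hgI⟩
  refine ⟨κ, Measure.eqOn_open_of_ae_eq (μ := volume) ?_ I.isOpen hc continuousOn_const⟩
  exact (ae_restrict_iff' I.isOpen.measurableSet).2 (hae.mono fun x hx hxI =>
    sub_eq_zero.1 (hx hxI))

theorem hasDerivAt_of_integral_deriv_smul_eq_neg (hI : (I : Set ℝ).OrdConnected) {a b : ℝ → E}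
    (ha : ContinuousOn a I) (hb : ContinuousOn b I)
    (hw : ∀ θ : 𝓓(I, ℝ), ∫ t, deriv θ t • a t = - ∫ t, θ t • b t) {t : ℝ} (ht : t ∈ I) :
    HasDerivAt a (b t) t := by
  set B : ℝ → E := fun s => ∫ r in t..s, b r
  have hB : ∀ s ∈ I, HasDerivAt B (b s) s := fun s hs =>
    intervalIntegral.integral_hasDerivAt_right
      ((hb.mono (hI.uIcc_subset ht hs)).intervalIntegrable)
      (hb.stronglyMeasurableAtFilter I.isOpen s hs) (hb.continuousAt (I.isOpen.mem_nhds hs))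
  have hBc : ContinuousOn B I := fun s hs => (hB s hs).continuousAt.continuousWithinAt
  obtain ⟨κ, hκ⟩ := eqOn_const_of_integral_deriv_smul_eq_zero hI (ha.sub hBc) fun θ => by
    simp only [Pi.sub_apply, smul_sub]
    rw [integral_sub (integrable_deriv_testFunction_smul θ ha)
      (integrable_deriv_testFunction_smul θ hBc), hw, integral_deriv_smul_eq_neg hB hb, sub_self]
  refine ((hB t ht).const_add κ).congr_of_eventuallyEq ?_
  filter_upwards [I.isOpen.mem_nhds ht] with s hs
  exact sub_eq_iff_eq_add.1 (hκ hs)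

end WeakDerivative

section Convolution

variable {E : Type*} [NormedAddCommGroup E] [NormedSpace ℝ E] {k : ℝ → ℝ} {f g : ℝ → E}

theorem enorm_convolution_rpow_le {p : ℝ} (hp : 1 ≤ p) (hk : AEStronglyMeasurable k)
    (hg : AEStronglyMeasurable g) (x : ℝ) :
    ‖(k ⋆ g) x‖ₑ ^ p ≤ (∫⁻ z, ‖k z‖ₑ) ^ (p - 1) * ∫⁻ z, ‖k z‖ₑ * ‖g (x - z)‖ₑ ^ p := by
  have hp0 : 0 < p := one_pos.trans_le hp
  have hp1 : 0 ≤ (p - 1) / p := div_nonneg (sub_nonneg.2 hp) hp0.le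
  have hpp : (p - 1) / p + p⁻¹ = 1 := by field_simp; ring
  have hgx : AEMeasurable fun z => ‖g (x - z)‖ₑ :=
    (hg.comp_quasiMeasurePreserving (quasiMeasurePreserving_sub_left volume x)).enorm
  have hsplit : ∀ z, ‖k z‖ₑ * ‖g (x - z)‖ₑ
      = ‖k z‖ₑ ^ ((p - 1) / p) * (‖k z‖ₑ * ‖g (x - z)‖ₑ ^ p) ^ p⁻¹ := fun z => by
    rw [ENNReal.mul_rpow_of_nonneg _ _ (by positivity), ENNReal.rpow_rpow_inv hp0.ne',
      ← mul_assoc, ← ENNReal.rpow_add_of_nonneg _ _ hp1 (by positivity), hpp, ENNReal.rpow_one]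
  have hHolder := ENNReal.lintegral_mul_norm_pow_le hk.enorm
    (hk.enorm.mul (hgx.pow_const p)) hp1 (inv_nonneg.2 hp0.le) hpp
  calc ‖(k ⋆ g) x‖ₑ ^ p ≤ (∫⁻ z, ‖k z‖ₑ * ‖g (x - z)‖ₑ) ^ p := by
        gcongr
        exact (enorm_integral_le_lintegral_enorm _).trans_eq (by simp [enorm_smul])
    _ ≤ ((∫⁻ z, ‖k z‖ₑ) ^ ((p - 1) / p) * (∫⁻ z, ‖k z‖ₑ * ‖g (x - z)‖ₑ ^ p) ^ p⁻¹) ^ p := by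
        simp only [hsplit]
        gcongr
        exact hHolder
    _ = _ := by
        rw [ENNReal.mul_rpow_of_nonneg _ _ hp0.le, ← ENNReal.rpow_mul, div_mul_cancel₀ _ hp0.ne',
          ENNReal.rpow_inv_rpow hp0.ne']

theorem eLpNorm_convolution_le {p : ℝ≥0∞} (hp : 1 ≤ p) (hp' : p ≠ ⊤)
    (hk : AEStronglyMeasurable k) (hg : AEStronglyMeasurable g) :
    eLpNorm (k ⋆ g) p volume ≤ eLpNorm k 1 volume * eLpNorm g p volume := by
  have hp0 : p ≠ 0 := (one_pos.trans_le hp).ne'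
  have hP : 1 ≤ p.toReal := by simpa using ENNReal.toReal_mono hp' hp
  have hPpos : 0 < p.toReal := one_pos.trans_le hP
  have hmeas : AEMeasurable (Function.uncurry fun x z => ‖k z‖ₑ * ‖g (x - z)‖ₑ ^ p.toReal)
      (volume.prod volume) :=
    hk.comp_snd.enorm.mul ((hg.comp_quasiMeasurePreserving
      (quasiMeasurePreserving_sub_of_right_invariant volume volume)).enorm.pow_const _)
  rw [eLpNorm_one_eq_lintegral_enorm, eLpNorm_eq_lintegral_rpow_enorm_toReal hp0 hp',
    eLpNorm_eq_lintegral_rpow_enorm_toReal hp0 hp', one_div]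
  set A := ∫⁻ z, ‖k z‖ₑ
  refine (ENNReal.rpow_inv_le_iff hPpos).2 ?_
  calc ∫⁻ x, ‖(k ⋆ g) x‖ₑ ^ p.toReal
      ≤ ∫⁻ x, A ^ (p.toReal - 1) * ∫⁻ z, ‖k z‖ₑ * ‖g (x - z)‖ₑ ^ p.toReal :=
        lintegral_mono fun x => enorm_convolution_rpow_le hP hk hg x
    _ = A ^ (p.toReal - 1) * ∫⁻ z, ∫⁻ x, ‖k z‖ₑ * ‖g (x - z)‖ₑ ^ p.toReal := by
        rw [lintegral_const_mul'' _ (by simpa using hmeas.lintegral_prod_right'),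
          lintegral_lintegral_swap hmeas]
    _ = A ^ (p.toReal - 1) * (A * ∫⁻ x, ‖g x‖ₑ ^ p.toReal) := by
        congr 1
        rw [← lintegral_mul_const'' _ hk.enorm]
        refine lintegral_congr fun z => ?_
        rw [lintegral_const_mul' _ _ enorm_ne_top,
          lintegral_sub_right_eq_self (fun x => ‖g x‖ₑ ^ p.toReal)]
    _ = (A * (∫⁻ x, ‖g x‖ₑ ^ p.toReal) ^ p.toReal⁻¹) ^ p.toReal := by
        rw [ENNReal.mul_rpow_of_nonneg _ _ hPpos.le, ENNReal.rpow_inv_rpow hPpos.ne', ← mul_assoc]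
        congr 1
        nth_rw 2 [← ENNReal.rpow_one A]
        rw [← ENNReal.rpow_add_of_nonneg _ _ (sub_nonneg.2 hP) zero_le_one, sub_add_cancel]

theorem convolution_sub (hk : Continuous k) (hkc : HasCompactSupport k)
    (hf : LocallyIntegrable f) (hg : LocallyIntegrable g) (x : ℝ) :
    (k ⋆ fun y => f y - g y) x = (k ⋆ f) x - (k ⋆ g) x := by
  simp only [convolution_def, map_sub]
  exact integral_sub (hkc.convolutionExists_left _ hk hf x) (hkc.convolutionExists_left _ hk hg x)

theorem norm_convolution_le {M : ℝ} (hk : Integrable k) (hf : ∀ᵐ y, ‖f y‖ ≤ M) (x : ℝ) :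
    ‖(k ⋆ f) x‖ ≤ (∫ z, ‖k z‖) * M := by
  rw [← integral_mul_const]
  refine norm_integral_le_of_norm_le (hk.norm.mul_const M) ?_
  filter_upwards [(quasiMeasurePreserving_sub_left volume x).ae hf] with z hz
  simp only [ContinuousLinearMap.lsmul_apply, norm_smul]
  gcongr

theorem norm_normed_convolution_sub_le [CompleteSpace E] (φ : ContDiffBump (0 : ℝ)) {x r : ℝ}
    {z : E} (hf : LocallyIntegrable f) (h : ∀ᵐ y, |x - y| < φ.rOut → ‖f y - z‖ ≤ r) :
    ‖(φ.normed volume ⋆ f) x - z‖ ≤ r := by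
  have hz : z = ∫ t, φ.normed volume t • z := by rw [φ.integral_normed_smul]
  have hr : r = ∫ t, φ.normed volume t * r := by
    rw [integral_mul_const, φ.integral_normed, one_mul]
  rw [convolution_def, hz, hr, ← integral_sub (φ.hasCompactSupport_normed.convolutionExists_left _
    φ.continuous_normed hf x) (φ.integrable_normed.smul_const z)]
  refine norm_integral_le_of_norm_le (φ.integrable_normed.mul_const r) ?_
  filter_upwards [(quasiMeasurePreserving_sub_left volume x).ae h] with t ht
  rw [ContinuousLinearMap.lsmul_apply, ← smul_sub, norm_smul,
    Real.norm_of_nonneg (φ.nonneg_normed t)]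
  rcases lt_or_ge |t| φ.rOut with h' | h'
  · gcongr
    · exact φ.nonneg_normed t
    · exact ht (by simpa using h')
  · have h0 : φ.normed volume t = 0 := Function.notMem_support.1 fun ht' =>
      h'.not_gt (by simpa [φ.support_normed_eq] using ht')
    simp [h0]

end Convolution

section MollifiedDerivBound

variable {E : Type*} [NormedAddCommGroup E] [NormedSpace ℝ E] {f g : ℝ → E} {G : ℝ≥0}

/-- The bound `‖∂ₓ f‖_{L²} ≤ G`, stated for the derivatives `(∂ₓ φ) ⋆ f` of all mollifications of
`f`. In this form it makes no reference to weak derivatives and is stable under local convergence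
of `f`. -/
def MollifiedDerivBound (f : ℝ → E) (G : ℝ≥0) : Prop :=
  ∀ φ : ContDiffBump (0 : ℝ), eLpNorm (deriv (φ.normed volume) ⋆ f) 2 volume ≤ G

theorem HasWeakDeriv.deriv_convolution {f g : Wave} (h : HasWeakDeriv f g) {k : ℝ → ℝ}
    (hk : ContDiff ℝ ∞ k) (hkc : HasCompactSupport k) : deriv k ⋆ f = k ⋆ g := by
  ext x
  have htest : ∫ y, f y * deriv (fun y => (k (x - y) : ℂ)) y = -∫ y, g y * (k (x - y) : ℂ) :=
    h.2.2 ⟨fun y => (k (x - y) : ℂ),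
      Complex.ofRealCLM.contDiff.comp (hk.comp (contDiff_const.sub contDiff_id)),
      (hkc.comp_homeomorph (Homeomorph.subLeft x)).comp_left Complex.ofReal_zero, by simp⟩
  have hderiv (y : ℝ) : deriv (fun y => (k (x - y) : ℂ)) y = -((deriv k (x - y) : ℝ) : ℂ) := by
    have hd := (hk.differentiable (by simp) (x - y)).hasDerivAt.comp_const_sub x y
    simpa using hd.ofReal_comp.deriv
  simp only [hderiv, mul_neg, integral_neg, neg_inj] at htest
  simp only [convolution_eq_swap, ContinuousLinearMap.lsmul_apply, Complex.real_smul]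
  simpa only [mul_comm] using htest

theorem eLpNorm_normed_one (φ : ContDiffBump (0 : ℝ)) : eLpNorm (φ.normed volume) 1 volume = 1 := by
  rw [eLpNorm_one_eq_lintegral_enorm, ← ofReal_integral_norm_eq_lintegral_enorm φ.integrable_normed]
  simp only [Real.norm_of_nonneg (φ.nonneg_normed _), φ.integral_normed, ENNReal.ofReal_one]

theorem mollifiedDerivBound_of_hDotOneSeminorm_le {f : Wave} (h : hDotOneSeminorm f ≤ G) :
    MollifiedDerivBound f G := by
  refine fun φ => (le_iInf₂ fun g hg => ?_).trans h
  rw [hg.deriv_convolution φ.contDiff_normed φ.hasCompactSupport_normed]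
  refine (eLpNorm_convolution_le one_le_two (by simp) φ.continuous_normed.aestronglyMeasurable
    (AEEqFun.aestronglyMeasurable g)).trans_eq ?_
  rw [eLpNorm_normed_one, one_mul]

theorem norm_sub_le_mul_sqrt_of_eLpNorm_le [CompleteSpace E] {v v' : ℝ → E}
    (hv : ∀ x, HasDerivAt v (v' x) x) (hc : Continuous v') (hG : eLpNorm v' 2 volume ≤ G)
    (x y : ℝ) : ‖v x - v y‖ ≤ G * √|x - y| := by
  rw [← intervalIntegral.integral_eq_sub_of_hasDerivAt (fun z _ => hv z)
    (hc.intervalIntegrable y x), intervalIntegral.norm_intervalIntegral_eq]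
  refine (ENNReal.ofReal_le_ofReal_iff (by positivity)).1 ?_
  calc ENNReal.ofReal ‖∫ z in Set.uIoc y x, v' z‖
      ≤ eLpNorm v' 1 (volume.restrict (Set.uIoc y x)) := by
        rw [ofReal_norm, eLpNorm_one_eq_lintegral_enorm]
        exact enorm_integral_le_lintegral_enorm _
    _ ≤ eLpNorm v' 2 volume * volume (Set.uIoc y x) ^ (1 / 2 : ℝ) := by
        have hHolder := eLpNorm_le_eLpNorm_mul_rpow_measure_univ (p := 1) (q := 2)
          (μ := volume.restrict (Set.uIoc y x)) one_le_two hc.aestronglyMeasurable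
        rw [Measure.restrict_apply_univ] at hHolder
        refine hHolder.trans
          (mul_le_mul' (eLpNorm_mono_measure _ Measure.restrict_le_self) (le_of_eq ?_))
        norm_num
    _ ≤ ENNReal.ofReal (G * √|x - y|) := by
        rw [ENNReal.ofReal_mul G.coe_nonneg, ENNReal.ofReal_coe_nnreal, Real.volume_uIoc,
          ENNReal.ofReal_rpow_of_nonneg (abs_nonneg _) (by norm_num), ← Real.sqrt_eq_rpow]
        gcongr

theorem MollifiedDerivBound.norm_convolution_sub_le [CompleteSpace E] (h : MollifiedDerivBound f G)
    (hf : LocallyIntegrable f) (φ : ContDiffBump (0 : ℝ)) (x y : ℝ) :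
    ‖(φ.normed volume ⋆ f) x - (φ.normed volume ⋆ f) y‖ ≤ G * √|x - y| :=
  norm_sub_le_mul_sqrt_of_eLpNorm_le
    (fun z => φ.hasCompactSupport_normed.hasDerivAt_convolution_left _ φ.contDiff_normed hf z)
    (φ.hasCompactSupport_normed.deriv.continuous_convolution_left _
      (φ.contDiff_normed (n := 1).continuous_deriv le_rfl) hf) (h φ) x y

variable [CompleteSpace E]

variable (E) in
theorem exists_seq_normed_convolution_tendsto :
    ∃ φ : ℕ → ContDiffBump (0 : ℝ), ∀ f : ℝ → E, LocallyIntegrable f →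
      ∀ᵐ x, Tendsto (fun n => ((φ n).normed volume ⋆ f) x) atTop (𝓝 (f x)) :=
  ⟨fun n => ⟨1 / (n + 1) / 2, 1 / (n + 1), by positivity, half_lt_self (by positivity)⟩,
    fun _ hf => ContDiffBump.ae_convolution_tendsto_right_of_locallyIntegrable (K := 2)
      tendsto_one_div_add_atTop_nhds_zero_nat (Eventually.of_forall fun n => by simp; linarith) hf⟩

theorem MollifiedDerivBound.ae_norm_sub_le (h : MollifiedDerivBound f G)
    (hf : LocallyIntegrable f) : ∀ᵐ x, ∀ᵐ y, ‖f y - f x‖ ≤ G * √|y - x| := by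
  obtain ⟨φ, hφ⟩ := exists_seq_normed_convolution_tendsto E
  filter_upwards [hφ f hf] with x hx
  filter_upwards [hφ f hf] with y hy
  exact le_of_tendsto (hy.sub hx).norm (.of_forall fun n => h.norm_convolution_sub_le hf (φ n) y x)

theorem MollifiedDerivBound.ae_norm_convolution_sub_self_le (h : MollifiedDerivBound f G)
    (hf : LocallyIntegrable f) (φ : ContDiffBump (0 : ℝ)) :
    ∀ᵐ x, ‖(φ.normed volume ⋆ f) x - f x‖ ≤ G * √φ.rOut := by
  filter_upwards [h.ae_norm_sub_le hf] with x hx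
  refine norm_normed_convolution_sub_le φ hf (hx.mono fun y hy hyx => hy.trans ?_)
  rw [abs_sub_comm]
  gcongr

theorem MollifiedDerivBound.norm_convolution_le_of_ae_norm_le {F : Type*} [NormedAddCommGroup F]
    [NormedSpace ℝ F] [CompleteSpace F] {g : ℝ → F} {L : ℝ} (h : MollifiedDerivBound f G)
    (hf : LocallyIntegrable f) (hg : LocallyIntegrable g) (hL : 0 ≤ L)
    (hgf : ∀ᵐ y, ‖g y‖ ≤ L * ‖f y‖) (φ : ContDiffBump (0 : ℝ)) (x : ℝ) :
    ‖(φ.normed volume ⋆ g) x‖ ≤ L * (‖(φ.normed volume ⋆ f) x‖ + 2 * G * √φ.rOut) := by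
  rw [← sub_zero ((φ.normed volume ⋆ g) x)]
  refine norm_normed_convolution_sub_le φ hg ?_
  filter_upwards [hgf, h.ae_norm_convolution_sub_self_le hf φ] with y hy hfy hxy
  rw [sub_zero]
  refine hy.trans (mul_le_mul_of_nonneg_left ?_ hL)
  have hvy : ‖(φ.normed volume ⋆ f) x - (φ.normed volume ⋆ f) y‖ ≤ G * √φ.rOut :=
    (h.norm_convolution_sub_le hf φ x y).trans (by gcongr)
  linarith [norm_le_norm_add_norm_sub' (f y) ((φ.normed volume ⋆ f) y),
    norm_le_norm_add_norm_sub ((φ.normed volume ⋆ f) x) ((φ.normed volume ⋆ f) y),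
    norm_sub_rev (f y) ((φ.normed volume ⋆ f) y)]

end MollifiedDerivBound

section Curve

variable {I : Opens ℝ} {q : ℝ → Wave} {k : ℝ → ℝ} {t : ℝ}

theorem enorm_convolution_le_eLpNorm_restrict {E : Type*} [NormedAddCommGroup E] [NormedSpace ℝ E]
    {f : ℝ → E} (hk : AEStronglyMeasurable k) (hf : AEStronglyMeasurable f) (x : ℝ) :
    ‖(k ⋆ f) x‖ₑ ≤
      eLpNorm k 2 volume * eLpNorm f 2 (volume.restrict (tsupport fun y => k (x - y))) := by
  have hkx : AEStronglyMeasurable fun y => k (x - y) :=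
    hk.comp_quasiMeasurePreserving (quasiMeasurePreserving_sub_left volume x)
  have hsupp : ∀ y ∉ tsupport (fun y => k (x - y)), k (x - y) • f y = 0 := fun y hy => by
    rw [image_eq_zero_of_notMem_tsupport (f := fun y => k (x - y)) hy, zero_smul]
  rw [convolution_eq_swap]
  simp only [ContinuousLinearMap.lsmul_apply]
  rw [← setIntegral_eq_integral_of_forall_compl_eq_zero hsupp]
  refine (enorm_integral_le_lintegral_enorm _).trans ?_
  rw [← eLpNorm_one_eq_lintegral_enorm]
  refine (eLpNorm_smul_le_mul_eLpNorm (p := 2) (q := 2) hf.restrict hkx.restrict).trans ?_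
  gcongr
  rw [← eLpNorm_comp_measurePreserving hk (Measure.measurePreserving_sub_left volume x)]
  exact eLpNorm_mono_measure _ Measure.restrict_le_self

theorem ContinuousL2loc.locallyIntegrable (h : ContinuousL2loc I q) (ht : t ∈ I) :
    LocallyIntegrable (q t) :=
  locallyIntegrable_iff.2 fun K hK =>
    have := isFiniteMeasure_restrict (μ := volume) |>.2 hK.measure_lt_top.ne
    ((h K hK).1 t ht).integrable one_le_two

theorem ContinuousL2loc.continuousOn_convolution (h : ContinuousL2loc I q) (hk : Continuous k)
    (hkc : HasCompactSupport k) (x : ℝ) : ContinuousOn (fun s => (k ⋆ q s) x) I := by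
  intro t ht
  set K := tsupport fun y => k (x - y)
  have hK : IsCompact K := hkc.comp_homeomorph (Homeomorph.subLeft x)
  have hk2 : eLpNorm k 2 volume ≠ ⊤ := (hk.memLp_of_hasCompactSupport hkc).eLpNorm_ne_top
  have hlim := ENNReal.Tendsto.const_mul ((h K hK).2 t ht) (.inr hk2)
  rw [mul_zero] at hlim
  refine tendsto_iff_edist_tendsto_0.2 (tendsto_of_tendsto_of_tendsto_of_le_of_le'
    tendsto_const_nhds hlim (.of_forall fun _ => zero_le) ?_)
  filter_upwards [self_mem_nhdsWithin] with s hs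
  rw [edist_eq_enorm_sub, ← convolution_sub hk hkc (h.locallyIntegrable hs)
    (h.locallyIntegrable ht)]
  refine (enorm_convolution_le_eLpNorm_restrict hk.aestronglyMeasurable
    ((AEEqFun.aestronglyMeasurable _).sub (AEEqFun.aestronglyMeasurable _)) x).trans_eq ?_
  rw [eLpNorm_congr_ae (ae_restrict_of_ae (AEEqFun.coeFn_sub (q s) (q t)))]

theorem mem_closure_of_ae_restrict {P : ℝ → Prop} (h : ∀ᵐ s ∂volume.restrict (I : Set ℝ), P s)
    (ht : t ∈ I) : t ∈ closure {s | s ∈ I ∧ P s} := by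
  have hdense : Dense {s | s ∈ (I : Set ℝ) → P s} :=
    Measure.dense_of_ae (μ := volume) ((ae_restrict_iff' I.isOpen.measurableSet).1 h)
  refine closure_mono ?_ (hdense.open_subset_closure_inter I.isOpen ht)
  exact fun s hs => ⟨hs.1, hs.2 hs.1⟩

theorem aestronglyMeasurable_convolution {E : Type*} [NormedAddCommGroup E] [NormedSpace ℝ E]
    {f : ℝ → E} (hk : AEStronglyMeasurable k) (hf : AEStronglyMeasurable f) :
    AEStronglyMeasurable (k ⋆ f) :=
  (hk.convolution_integrand (μ := volume) (ContinuousLinearMap.lsmul ℝ ℝ) hf).integral_prod_right'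

section

variable {S : Set ℝ} (h : ContinuousL2loc I q) (hS : S ⊆ I) (ht : t ∈ I) (hSt : t ∈ closure S)

include h hS ht hSt

theorem ContinuousL2loc.ae_norm_le_of_mem_closure {M : ℝ} (hM : ∀ s ∈ S, ∀ᵐ x, ‖q s x‖ ≤ M) :
    ∀ᵐ x, ‖q t x‖ ≤ M := by
  have := mem_closure_iff_nhdsWithin_neBot.1 hSt
  obtain ⟨φ, hφ⟩ := exists_seq_normed_convolution_tendsto ℂ
  filter_upwards [hφ (q t) (h.locallyIntegrable ht)] with x hx
  refine le_of_tendsto hx.norm (.of_forall fun n => ?_)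
  have hlim := ((h.continuousOn_convolution ((φ n).continuous_normed (μ := volume))
    (φ n).hasCompactSupport_normed x) t ht).mono hS
  refine le_of_tendsto hlim.norm ?_
  filter_upwards [self_mem_nhdsWithin] with s hs
  refine (norm_convolution_le (φ n).integrable_normed (hM s hs) x).trans_eq ?_
  simp only [Real.norm_of_nonneg ((φ n).nonneg_normed _), (φ n).integral_normed, one_mul]

theorem ContinuousL2loc.mollifiedDerivBound_of_mem_closure {G : ℝ≥0}
    (hG : ∀ s ∈ S, MollifiedDerivBound (q s) G) : MollifiedDerivBound (q t) G := by
  have := mem_closure_iff_nhdsWithin_neBot.1 hSt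
  intro φ
  have hc : Continuous (deriv (φ.normed volume)) :=
    φ.contDiff_normed (n := 1) |>.continuous_deriv le_rfl
  refine Lp.eLpNorm_le_of_ae_tendsto (u := 𝓝[S] t)
    (f := fun s => deriv (φ.normed volume) ⋆ (q s : ℝ → ℂ)) ?_
    (fun s => aestronglyMeasurable_convolution hc.aestronglyMeasurable
      (AEEqFun.aestronglyMeasurable _)) (.of_forall fun x => ?_)
  · filter_upwards [self_mem_nhdsWithin] with s hs using hG s hs φ
  · exact ((h.continuousOn_convolution hc φ.hasCompactSupport_normed.deriv x) t ht).mono hS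

end

theorem ContinuousL2loc.exists_forall_bound (h : ContinuousL2loc I q)
    (hb : BoundedLinftyHDotOne I q) :
    ∃ M : ℝ≥0, ∀ t ∈ I, (∀ᵐ x, ‖q t x‖ ≤ M) ∧ MollifiedDerivBound (q t) M := by
  obtain ⟨M, hM⟩ := hb
  refine ⟨M, fun t ht => ?_⟩
  have hmem := mem_closure_of_ae_restrict hM ht
  refine ⟨h.ae_norm_le_of_mem_closure (fun s hs => hs.1) ht hmem fun s hs => ?_,
    h.mollifiedDerivBound_of_mem_closure (fun s hs => hs.1) ht hmem fun s hs =>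
      mollifiedDerivBound_of_hDotOneSeminorm_le hs.2.2⟩
  filter_upwards [ae_le_eLpNormEssSup (f := q s) (μ := volume)] with x hx
  rw [← eLpNorm_exponent_top] at hx
  exact_mod_cast enorm_le_coe.1 (hx.trans hs.2.1)

theorem ae_norm_comp_sub_comp_le {f g : Wave} {N : ℂ → ℂ} (hN : Continuous N) {M : ℝ} {L : ℝ≥0}
    (hL : LipschitzOnWith L N (Metric.closedBall 0 M)) (hf : ∀ᵐ x, ‖f x‖ ≤ M)
    (hg : ∀ᵐ x, ‖g x‖ ≤ M) :
    ∀ᵐ x, ‖(f.comp N hN - g.comp N hN : Wave) x‖ ≤ L * ‖(f - g : Wave) x‖ := by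
  filter_upwards [hf, hg, AEEqFun.coeFn_sub f g, AEEqFun.coeFn_sub (f.comp N hN) (g.comp N hN),
    AEEqFun.coeFn_comp N hN f, AEEqFun.coeFn_comp N hN g] with x hfx hgx hsub hNsub hNf hNg
  rw [hsub, hNsub, Pi.sub_apply, Pi.sub_apply, hNf, hNg]
  exact hL.norm_sub_le (mem_closedBall_zero_iff.2 hfx) (mem_closedBall_zero_iff.2 hgx)

theorem ContinuousL2loc.comp (h : ContinuousL2loc I q) {M : ℝ}
    (hM : ∀ t ∈ I, ∀ᵐ x, ‖q t x‖ ≤ M) {N : ℂ → ℂ} (hN : Continuous N) {L : ℝ≥0}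
    (hL : LipschitzOnWith L N (Metric.closedBall 0 M)) :
    ContinuousL2loc I fun t => (q t).comp N hN := by
  refine fun K hK => ⟨fun t ht => ?_, fun t₀ ht₀ => ?_⟩
  · have := isFiniteMeasure_restrict (μ := volume) |>.2 hK.measure_lt_top.ne
    obtain ⟨C, hC⟩ := (isCompact_closedBall (0 : ℂ) M).exists_bound_of_continuousOn
      hN.continuousOn
    refine MemLp.of_bound (AEEqFun.aestronglyMeasurable _).restrict C (ae_restrict_of_ae ?_)
    filter_upwards [hM t ht, AEEqFun.coeFn_comp N hN (q t)] with x hx hNx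
    rw [hNx]
    exact hC _ (mem_closedBall_zero_iff.2 hx)
  · have hlim := ENNReal.Tendsto.const_mul ((h K hK).2 t₀ ht₀) (.inr (ENNReal.coe_ne_top (r := L)))
    rw [mul_zero] at hlim
    refine tendsto_of_tendsto_of_tendsto_of_le_of_le' tendsto_const_nhds hlim
      (.of_forall fun _ => zero_le) ?_
    filter_upwards [self_mem_nhdsWithin] with t ht
    refine (eLpNorm_le_nnreal_smul_eLpNorm_of_ae_le_mul (c := L) (ae_restrict_of_ae ?_) 2).trans_eq
      (ENNReal.smul_def _ _)
    exact ae_norm_comp_sub_comp_le hN hL (hM t ht) (hM t₀ ht₀)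

end Curve

section Equation

variable {I : Opens ℝ} {a b : ℝ → ℝ}

/-- The nonlinear term `2 (|z|² - 1) z` of the Gross–Pitaevskii equation. -/
noncomputable def nonlinearity (z : ℂ) : ℂ := 2 * ((‖z‖ : ℂ) ^ 2 - 1) * z

theorem contDiff_nonlinearity {n : ℕ∞} : ContDiff ℝ n nonlinearity := by
  have hsq : ContDiff ℝ n fun z : ℂ => (‖z‖ : ℂ) ^ 2 := by
    simpa [Function.comp_def] using
      Complex.ofRealCLM.contDiff.comp (contDiff_norm_sq ℝ (E := ℂ) (n := n))
  exact (contDiff_const.mul (hsq.sub contDiff_const)).mul contDiff_id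

theorem continuous_nonlinearity : Continuous nonlinearity :=
  (contDiff_nonlinearity (n := 0)).continuous

theorem exists_lipschitzOnWith_nonlinearity (M : ℝ) :
    ∃ L, LipschitzOnWith L nonlinearity (Metric.closedBall 0 M) :=
  (contDiff_nonlinearity (n := 1)).contDiffOn.exists_lipschitzOnWith one_ne_zero
    (convex_closedBall 0 M) (isCompact_closedBall 0 M)

theorem tsupport_prod_mul_subset (a b : ℝ → ℝ) :
    tsupport (fun p : ℝ × ℝ => ((a p.1 * b p.2 : ℝ) : ℂ)) ⊆ tsupport a ×ˢ tsupport b := by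
  rw [tsupport, tsupport, tsupport, ← closure_prod_eq]
  refine closure_mono fun p hp => ?_
  simpa [not_or] using hp

/-- The test function `a(t) b(x)` on `I × ℝ`. It takes values in `ℂ` because (GP) is tested
against complex functions. -/
noncomputable def prodTestFunction {n : ℕ∞} (ha : ContDiff ℝ n a) (hb : ContDiff ℝ n b)
    (hac : HasCompactSupport a) (hbc : HasCompactSupport b) (haI : tsupport a ⊆ I) :
    𝓓^{n}(slab I, ℂ) where
  toFun p := (a p.1 * b p.2 : ℝ)
  contDiff' := Complex.ofRealCLM.contDiff.comp
    ((ha.comp contDiff_fst).mul (hb.comp contDiff_snd))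
  hasCompactSupport' := (hac.isCompact.prod hbc.isCompact).of_isClosed_subset (isClosed_tsupport _)
    (tsupport_prod_mul_subset a b)
  tsupport_subset' := (tsupport_prod_mul_subset a b).trans (Set.prod_mono haI (Set.subset_univ _))

section

variable (ha : Continuous a) (hb : Continuous b) (hac : HasCompactSupport a)
  (hbc : HasCompactSupport b) (haI : tsupport a ⊆ I) {h : ℝ × ℝ → ℂ}
  (hh : LocallyIntegrableOn h (slab I))

include ha hb hac hbc haI hh

theorem integrable_prod_smul : Integrable fun p : ℝ × ℝ => (a p.1 * b p.2) • h p := by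
  simpa [prodTestFunction] using (prodTestFunction (n := 0) (contDiff_zero.2 ha)
    (contDiff_zero.2 hb) hac hbc haI).integrable_bilin (ContinuousLinearMap.mul ℝ ℂ) hh

theorem setIntegral_slab_prod_smul : ∫ p in (slab I : Set (ℝ × ℝ)), (a p.1 * b p.2) • h p =
    ∫ t in (I : Set ℝ), a t • ∫ y, b y • h (t, y) := by
  simp only [← integral_smul, smul_smul]
  have hint := (integrable_prod_smul ha hb hac hbc haI hh).integrableOn (s := slab I)
  rw [Measure.volume_eq_prod] at hint ⊢
  exact (setIntegral_prod _ hint).trans (by rw [Measure.restrict_univ])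

end

theorem deriv_ofReal_comp {g : ℝ → ℝ} (hg : Differentiable ℝ g) :
    deriv (fun x => (g x : ℂ)) = fun x => ((deriv g x : ℝ) : ℂ) :=
  funext fun x => (hg x).hasDerivAt.ofReal_comp.deriv

theorem SolvesGPWeakly.setIntegral_slab_eq_zero {u : ℝ × ℝ → ℂ} (hu : SolvesGPWeakly I u)
    (θ : 𝓓(I, ℝ)) {κ : ℝ → ℝ} (hκ : ContDiff ℝ ∞ κ) (hκc : HasCompactSupport κ) :
    ∫ p in (slab I : Set (ℝ × ℝ)), (-Complex.I * (deriv θ p.1 * κ p.2) • u p +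
      (θ p.1 * deriv (deriv κ) p.2) • u p - (θ p.1 * κ p.2) • nonlinearity (u p)) = 0 := by
  rw [← hu.2.2 (prodTestFunction θ.contDiff hκ θ.hasCompactSupport hκc θ.tsupport_subset)]
  refine integral_congr_ae (.of_forall fun p => ?_)
  have hθ : Differentiable ℝ θ := θ.contDiff.differentiable (by simp)
  have hκ1 : Differentiable ℝ κ := hκ.differentiable (by simp)
  have hκ2 : Differentiable ℝ (deriv κ) :=
    (contDiff_infty_iff_deriv.1 hκ).2.differentiable (by simp)
  have htime : deriv (fun s => ((θ s * κ p.2 : ℝ) : ℂ)) p.1 = (deriv θ p.1 * κ p.2 : ℝ) := by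
    simp only [deriv_ofReal_comp (hθ.mul_const _), deriv_mul_const (hθ _)]
  have hspace : iteratedDeriv 2 (fun y => ((θ p.1 * κ y : ℝ) : ℂ)) p.2 =
      (θ p.1 * deriv (deriv κ) p.2 : ℝ) := by
    rw [iteratedDeriv_succ, iteratedDeriv_one]
    simp only [deriv_ofReal_comp (hκ1.const_mul _), deriv_const_mul _ (hκ1 _),
      deriv_ofReal_comp (hκ2.const_mul _), deriv_const_mul _ (hκ2 _)]
  change _ = u p * (-Complex.I * deriv (fun s => ((θ s * κ p.2 : ℝ) : ℂ)) p.1 +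
    iteratedDeriv 2 (fun y => ((θ p.1 * κ y : ℝ) : ℂ)) p.2) -
    nonlinearity (u p) * ((θ p.1 * κ p.2 : ℝ) : ℂ)
  rw [htime, hspace]
  simp only [Complex.real_smul]
  ring

theorem SolvesGPWeakly.setIntegral_eq_zero {u : ℝ × ℝ → ℂ} (hu : SolvesGPWeakly I u)
    (θ : 𝓓(I, ℝ)) {κ : ℝ → ℝ} (hκ : ContDiff ℝ ∞ κ) (hκc : HasCompactSupport κ) :
    -Complex.I * (∫ t in (I : Set ℝ), deriv θ t • ∫ y, κ y • u (t, y)) +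
      (∫ t in (I : Set ℝ), θ t • ∫ y, deriv (deriv κ) y • u (t, y)) -
      ∫ t in (I : Set ℝ), θ t • ∫ y, κ y • nonlinearity (u (t, y)) = 0 := by
  have hN : LocallyIntegrableOn (fun p => nonlinearity (u p)) (slab I) := hu.2.1
  have hθ := θ.contDiff.continuous
  have hθc := θ.hasCompactSupport
  have hθ' : Continuous (deriv θ) := θ.contDiff.continuous_deriv (by simp)
  have hθs : tsupport (deriv θ) ⊆ I := tsupport_deriv_subset.trans θ.tsupport_subset
  have hκ'' : Continuous (deriv (deriv κ)) :=
    (contDiff_infty_iff_deriv.1 hκ).2.continuous_deriv (by simp)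
  have i1 := integrable_prod_smul hθ' hκ.continuous hθc.deriv hκc hθs hu.1
  have i2 := integrable_prod_smul hθ hκ'' hθc hκc.deriv.deriv θ.tsupport_subset hu.1
  have i3 := integrable_prod_smul hθ hκ.continuous hθc hκc θ.tsupport_subset hN
  have i12 : Integrable fun p : ℝ × ℝ => -Complex.I * (deriv θ p.1 * κ p.2) • u p +
    (θ p.1 * deriv (deriv κ) p.2) • u p := (i1.const_mul _).add i2
  rw [← setIntegral_slab_prod_smul hθ' hκ.continuous hθc.deriv hκc hθs hu.1,
    ← setIntegral_slab_prod_smul hθ hκ'' hθc hκc.deriv.deriv θ.tsupport_subset hu.1,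
    ← setIntegral_slab_prod_smul hθ hκ.continuous hθc hκc θ.tsupport_subset hN,
    ← integral_const_mul, ← integral_add (i1.const_mul _).restrict i2.restrict,
    ← integral_sub i12.restrict i3.restrict]
  exact hu.setIntegral_slab_eq_zero θ hκ hκc

theorem deriv_deriv_comp_const_sub (k : ℝ → ℝ) (x : ℝ) :
    deriv (deriv fun y => k (x - y)) = fun y => deriv (deriv k) (x - y) := by
  simpa [iteratedDeriv_succ, iteratedDeriv_one] using
    iteratedDeriv_comp_const_sub (n := 2) (f := k) (s := x)

theorem IsDistributionalSolution.integral_convolution_eq_zero {q : ℝ → Wave}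
    (hs : IsDistributionalSolution I q) (θ : 𝓓(I, ℝ)) {k : ℝ → ℝ} (hk : ContDiff ℝ ∞ k)
    (hkc : HasCompactSupport k) (x : ℝ) :
    -Complex.I * (∫ t, deriv θ t • (k ⋆ q t) x) + (∫ t, θ t • (deriv (deriv k) ⋆ q t) x) -
      ∫ t, θ t • (k ⋆ (q t).comp nonlinearity continuous_nonlinearity) x = 0 := by
  obtain ⟨u, huq, hu⟩ := hs
  have heq := hu.setIntegral_eq_zero θ (κ := fun y => k (x - y))
    (hk.comp (contDiff_const.sub contDiff_id)) (hkc.comp_homeomorph (Homeomorph.subLeft x))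
  rw [deriv_deriv_comp_const_sub] at heq
  have hslice : ∀ g a : ℝ → ℝ, tsupport a ⊆ I → ∀ N : ℂ → ℂ, ∀ hN : Continuous N,
      ∫ t in (I : Set ℝ), a t • (∫ y, g (x - y) • N (u (t, y))) =
        ∫ t, a t • (g ⋆ (q t).comp N hN) x := fun g a ha N hN => by
    have hout : ∀ t ∉ (I : Set ℝ), a t • (g ⋆ (q t).comp N hN) x = 0 := fun t ht => by
      rw [image_eq_zero_of_notMem_tsupport fun h => ht (ha h), zero_smul]
    rw [← setIntegral_eq_integral_of_forall_compl_eq_zero hout]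
    refine integral_congr_ae ?_
    filter_upwards [huq] with t ht
    rw [convolution_eq_swap]
    refine congrArg (a t • ·) (integral_congr_ae ?_)
    filter_upwards [ht, AEEqFun.coeFn_comp N hN (q t)] with y hy hNy
    rw [hNy, Function.comp_apply, ← hy, ContinuousLinearMap.lsmul_apply]
  have hid : ∀ g a : ℝ → ℝ, tsupport a ⊆ I →
      ∫ t in (I : Set ℝ), a t • ∫ y, g (x - y) • u (t, y) = ∫ t, a t • (g ⋆ q t) x :=
    fun g a ha => by simpa only [id, AEEqFun.comp_id] using hslice g a ha id continuous_id
  rwa [hid _ _ (tsupport_deriv_subset.trans θ.tsupport_subset), hid _ _ θ.tsupport_subset,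
    hslice _ _ θ.tsupport_subset _ continuous_nonlinearity] at heq

theorem IsDistributionalSolution.hasDerivAt_convolution {q : ℝ → Wave} {M : ℝ≥0}
    (hs : IsDistributionalSolution I q) (hI : (I : Set ℝ).OrdConnected) (hc : ContinuousL2loc I q)
    (hM : ∀ t ∈ I, ∀ᵐ x, ‖q t x‖ ≤ M) {k : ℝ → ℝ} (hk : ContDiff ℝ ∞ k)
    (hkc : HasCompactSupport k) (x : ℝ) {t : ℝ} (ht : t ∈ I) :
    HasDerivAt (fun s => (k ⋆ q s) x) (Complex.I * ((deriv (deriv k) ⋆ q t) x -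
      (k ⋆ (q t).comp nonlinearity continuous_nonlinearity) x)) t := by
  obtain ⟨L, hL⟩ := exists_lipschitzOnWith_nonlinearity M
  have hk'' : Continuous (deriv (deriv k)) :=
    (contDiff_infty_iff_deriv.1 hk).2.continuous_deriv (by simp)
  have hq := hc.continuousOn_convolution hk.continuous hkc x
  have hq'' := hc.continuousOn_convolution hk'' hkc.deriv.deriv x
  have hN := (hc.comp hM continuous_nonlinearity hL).continuousOn_convolution hk.continuous hkc x
  have hrhs : ContinuousOn (fun s => Complex.I * ((deriv (deriv k) ⋆ q s) x -
      (k ⋆ (q s).comp nonlinearity continuous_nonlinearity) x)) I :=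
    continuousOn_const.mul (hq''.sub hN)
  refine hasDerivAt_of_integral_deriv_smul_eq_neg hI hq hrhs (fun θ => ?_) ht
  have heq := hs.integral_convolution_eq_zero θ hk hkc x
  simp only [← mul_smul_comm, smul_sub]
  rw [integral_const_mul, integral_sub (integrable_testFunction_smul θ hq'')
    (integrable_testFunction_smul θ hN)]
  linear_combination Complex.I * heq + (∫ t, deriv θ t • (k ⋆ q t) x) * Complex.I_mul_I

end Equation

section Weight

/-- The weight `1 / (1 + (δ x)²)`, integrable of width `1 / δ`. Its derivative is at most `δ` times
the weight itself, so that localizing the energy costs little for small `δ`. -/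
noncomputable def weight (δ x : ℝ) : ℝ := (1 + (δ * x) ^ 2)⁻¹

variable {δ : ℝ}

theorem weight_pos (δ x : ℝ) : 0 < weight δ x := by
  unfold weight
  positivity

theorem weight_le_one (δ x : ℝ) : weight δ x ≤ 1 :=
  inv_le_one_of_one_le₀ (le_add_of_nonneg_right (sq_nonneg _))

theorem weight_anti {δ' : ℝ} (h0 : 0 ≤ δ) (h : δ ≤ δ') (x : ℝ) : weight δ' x ≤ weight δ x := by
  unfold weight
  rw [mul_pow, mul_pow]
  gcongr

theorem hasDerivAt_weight (δ x : ℝ) :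
    HasDerivAt (weight δ) (-(2 * (δ * x) * δ) / (1 + (δ * x) ^ 2) ^ 2) x := by
  have h : HasDerivAt (fun x => 1 + (δ * x) ^ 2) (2 * (δ * x) * δ) x := by
    simpa using (((hasDerivAt_id x).const_mul δ).pow 2).const_add 1
  exact h.inv (by positivity)

theorem continuous_weight (δ : ℝ) : Continuous (weight δ) :=
  continuous_iff_continuousAt.2 fun x => (hasDerivAt_weight δ x).continuousAt

theorem abs_deriv_weight_le (hδ : 0 ≤ δ) (x : ℝ) : |deriv (weight δ) x| ≤ δ * weight δ x := by
  rw [(hasDerivAt_weight δ x).deriv, weight, abs_div, abs_neg, abs_mul, abs_of_nonneg hδ, abs_mul,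
    abs_two, abs_sq, ← div_eq_mul_inv,
    div_le_div_iff₀ (by positivity) (by positivity)]
  have h : 2 * |δ * x| ≤ 1 + (δ * x) ^ 2 := by
    rw [← sq_abs]
    linarith [two_mul_le_add_sq 1 |δ * x|]
  calc 2 * |δ * x| * δ * (1 + (δ * x) ^ 2)
      ≤ (1 + (δ * x) ^ 2) * δ * (1 + (δ * x) ^ 2) := by gcongr
    _ = δ * (1 + (δ * x) ^ 2) ^ 2 := by ring

theorem integrable_weight (hδ : δ ≠ 0) : Integrable (weight δ) :=
  integrable_inv_one_add_sq.comp_mul_left' hδ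

theorem integral_weight (hδ : 0 < δ) : ∫ x, weight δ x = Real.pi / δ := by
  have h := Measure.integral_comp_mul_left (fun x : ℝ => (1 + x ^ 2)⁻¹) δ
  rwa [integral_univ_inv_one_add_sq, abs_of_pos (inv_pos.2 hδ), smul_eq_mul,
    ← div_eq_inv_mul] at h

theorem integrable_weight_mul (hδ : δ ≠ 0) {f : ℝ → ℝ} (hf : AEStronglyMeasurable f volume) {C : ℝ}
    (hC : ∀ᵐ x, ‖f x‖ ≤ C) : Integrable fun x => weight δ x * f x :=
  (integrable_weight hδ).mul_bdd hf hC

theorem integrable_deriv_weight_mul (hδ : 0 < δ) {f : ℝ → ℝ} (hf : AEStronglyMeasurable f volume)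
    {C : ℝ} (hC : ∀ᵐ x, ‖f x‖ ≤ C) : Integrable fun x => deriv (weight δ) x * f x := by
  refine Integrable.mul_bdd ?_ hf hC
  exact ((integrable_weight hδ.ne').const_mul δ).mono'
    (measurable_deriv (weight δ)).aestronglyMeasurable (.of_forall (abs_deriv_weight_le hδ.le))

theorem integrable_weight_mul_norm_sq {E : Type*} [NormedAddCommGroup E] (hδ : δ ≠ 0)
    {f : ℝ → E} (hf : AEStronglyMeasurable f volume) {A : ℝ} (hA : ∀ᵐ x, ‖f x‖ ≤ A) :
    Integrable fun x => weight δ x * ‖f x‖ ^ 2 := by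
  refine integrable_weight_mul hδ (hf.norm.pow 2) (C := A ^ 2) (hA.mono fun x hx => ?_)
  rw [norm_pow, norm_norm]
  gcongr

theorem hasDerivAt_integral_weight_norm_sq {E : Type*} [NormedAddCommGroup E]
    [InnerProductSpace ℝ E] {I : Set ℝ} (hI : IsOpen I) (hδ : δ ≠ 0) {W V : ℝ → ℝ → E} {A B : ℝ}
    (hd : ∀ t ∈ I, ∀ x, HasDerivAt (fun s => W s x) (V t x) t)
    (hW : ∀ t ∈ I, Continuous (W t)) (hV : ∀ t ∈ I, Continuous (V t))
    (hA : ∀ t ∈ I, ∀ x, ‖W t x‖ ≤ A) (hB : ∀ t ∈ I, ∀ x, ‖V t x‖ ≤ B) {t : ℝ} (ht : t ∈ I) :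
    HasDerivAt (fun s => ∫ x, weight δ x * ‖W s x‖ ^ 2)
      (∫ x, weight δ x * (2 * inner ℝ (W t x) (V t x))) t := by
  have hbound : ∀ s ∈ I, ∀ x,
      ‖weight δ x * (2 * inner ℝ (W s x) (V s x))‖ ≤ weight δ x * (2 * (A * B)) := fun s hs x => by
    have hA0 : 0 ≤ A := (norm_nonneg _).trans (hA s hs x)
    rw [norm_mul, norm_mul, Real.norm_two, Real.norm_of_nonneg (weight_pos δ x).le]
    gcongr
    · exact (weight_pos δ x).le
    · exact (norm_inner_le_norm _ _).trans
        (mul_le_mul (hA s hs x) (hB s hs x) (norm_nonneg _) hA0)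
  refine (hasDerivAt_integral_of_dominated_loc_of_deriv_le (hI.mem_nhds ht) ?_
    (integrable_weight_mul_norm_sq hδ (hW t ht).aestronglyMeasurable (.of_forall (hA t ht))) ?_
    (.of_forall fun x s hs => hbound s hs x) ((integrable_weight hδ).mul_const _)
    (.of_forall fun x s hs => ((hd s hs x).norm_sq).const_mul _)).2
  · filter_upwards [hI.mem_nhds ht] with s hs
    exact ((continuous_weight δ).mul ((hW s hs).norm.pow 2)).aestronglyMeasurable
  · exact ((continuous_weight δ).mul
      (continuous_const.mul ((hW t ht).inner (hV t ht)))).aestronglyMeasurable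

end Weight

section EnergyEstimate

variable {δ : ℝ} {v v' v'' F : ℝ → ℂ} {A B C : ℝ}

theorem inner_I_mul_self (z : ℂ) : inner ℝ z (Complex.I * z) = 0 := by
  simp only [Complex.inner, Complex.mul_re, Complex.mul_im, Complex.conj_re, Complex.conj_im,
    Complex.I_re, Complex.I_im]
  ring

theorem norm_inner_I_mul_le (z w : ℂ) : ‖(inner ℝ z (Complex.I * w) : ℝ)‖ ≤ ‖z‖ * ‖w‖ := by
  simpa using norm_inner_le_norm (𝕜 := ℝ) z (Complex.I * w)

theorem norm_inner_I_mul_le_of_le {z w : ℂ} {a b : ℝ} (hz : ‖z‖ ≤ a) (hw : ‖w‖ ≤ b) :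
    ‖(inner ℝ z (Complex.I * w) : ℝ)‖ ≤ a * b :=
  (norm_inner_I_mul_le z w).trans (mul_le_mul hz hw (norm_nonneg _) ((norm_nonneg _).trans hz))

theorem integral_weight_mul_inner_I_mul_deriv_deriv (hδ : 0 < δ)
    (hv : ∀ x, HasDerivAt v (v' x) x) (hv' : ∀ x, HasDerivAt v' (v'' x) x) (hc : Continuous v'')
    (hA : ∀ x, ‖v x‖ ≤ A) (hB : ∀ x, ‖v' x‖ ≤ B) (hC : ∀ x, ‖v'' x‖ ≤ C) :
    ∫ x, weight δ x * inner ℝ (v x) (Complex.I * v'' x) =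
      -∫ x, deriv (weight δ) x * inner ℝ (v x) (Complex.I * v' x) := by
  have hvc : Continuous v := continuous_iff_continuousAt.2 fun x => (hv x).continuousAt
  have hvc' : Continuous v' := continuous_iff_continuousAt.2 fun x => (hv' x).continuousAt
  have hm : AEStronglyMeasurable (fun x => inner ℝ (v x) (Complex.I * v' x)) volume :=
    (hvc.inner (continuous_const.mul hvc')).aestronglyMeasurable
  have hb : ∀ᵐ x, ‖(inner ℝ (v x) (Complex.I * v' x) : ℝ)‖ ≤ A * B :=
    .of_forall fun x => norm_inner_I_mul_le_of_le (hA x) (hB x)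
  have i1 := integrable_deriv_weight_mul hδ hm hb
  have i2 : Integrable fun x => weight δ x * inner ℝ (v x) (Complex.I * v'' x) :=
    integrable_weight_mul hδ.ne' (hvc.inner (continuous_const.mul hc)).aestronglyMeasurable
      (.of_forall fun x => norm_inner_I_mul_le_of_le (hA x) (hC x))
  rw [eq_neg_iff_add_eq_zero, add_comm, ← integral_add i1 i2]
  refine integral_eq_zero_of_hasDerivAt_of_integrable (fun x => ?_) (i1.add i2)
    (integrable_weight_mul hδ.ne' hm hb)
  have hinner := (hv x).inner ℝ ((hv' x).const_mul Complex.I)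
  rw [inner_I_mul_self, add_zero] at hinner
  exact (hasDerivAt_weight δ x).differentiableAt.hasDerivAt.mul hinner

theorem integral_norm_sq_le_of_eLpNorm_le {α E : Type*} [MeasurableSpace α] {μ : Measure α}
    [NormedAddCommGroup E] {f : α → E} {G : ℝ≥0} (hf : AEStronglyMeasurable f μ)
    (hG : eLpNorm f 2 μ ≤ G) : ∫ x, ‖f x‖ ^ 2 ∂μ ≤ G ^ 2 := by
  have hL2 : MemLp f 2 μ := ⟨hf, hG.trans_lt ENNReal.coe_lt_top⟩
  rw [hL2.eLpNorm_eq_integral_rpow_norm two_ne_zero (by simp), ← ENNReal.ofReal_coe_nnreal,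
    ENNReal.ofReal_le_ofReal_iff G.coe_nonneg, ENNReal.toReal_ofNat, ← one_div,
    ← Real.sqrt_eq_rpow, Real.sqrt_le_left G.coe_nonneg] at hG
  exact_mod_cast hG

theorem norm_integral_deriv_weight_mul_inner_le {G : ℝ≥0} (hδ : 0 < δ) (hv : Continuous v)
    (hv' : AEStronglyMeasurable v' volume) (hA : ∀ x, ‖v x‖ ≤ A) (hG : eLpNorm v' 2 volume ≤ G) :
    ‖∫ x, deriv (weight δ) x * inner ℝ (v x) (Complex.I * v' x)‖ ≤
      δ / 2 * ((∫ x, weight δ x * ‖v x‖ ^ 2) + G ^ 2) := by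
  have iv : Integrable fun x => weight δ x * ‖v x‖ ^ 2 :=
    integrable_weight_mul_norm_sq hδ.ne' hv.aestronglyMeasurable (.of_forall hA)
  have iv' : Integrable fun x => ‖v' x‖ ^ 2 :=
    MemLp.integrable_norm_pow ⟨hv', hG.trans_lt ENNReal.coe_lt_top⟩ two_ne_zero
  have hbound : ∀ x, ‖deriv (weight δ) x * inner ℝ (v x) (Complex.I * v' x)‖ ≤
      δ / 2 * (weight δ x * ‖v x‖ ^ 2 + ‖v' x‖ ^ 2) := fun x => by
    have hw := weight_pos δ x
    calc ‖deriv (weight δ) x * inner ℝ (v x) (Complex.I * v' x)‖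
        ≤ (δ * weight δ x) * (‖v x‖ * ‖v' x‖) := by
          rw [norm_mul]
          exact mul_le_mul (abs_deriv_weight_le hδ.le x) (norm_inner_I_mul_le _ _)
            (norm_nonneg _) (by positivity)
      _ ≤ (δ * weight δ x) * ((‖v x‖ ^ 2 + ‖v' x‖ ^ 2) / 2) := by
          gcongr
          linarith [two_mul_le_add_sq ‖v x‖ ‖v' x‖]
      _ = δ / 2 * (weight δ x * ‖v x‖ ^ 2 + weight δ x * ‖v' x‖ ^ 2) := by ring
      _ ≤ δ / 2 * (weight δ x * ‖v x‖ ^ 2 + ‖v' x‖ ^ 2) := by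
          gcongr
          exact mul_le_of_le_one_left (sq_nonneg _) (weight_le_one δ x)
  refine (norm_integral_le_of_norm_le ((iv.add iv').const_mul _) (.of_forall hbound)).trans ?_
  simp only [Pi.add_apply]
  rw [integral_const_mul, integral_add iv iv']
  gcongr
  exact integral_norm_sq_le_of_eLpNorm_le hv' hG

theorem norm_integral_weight_mul_inner_forcing_le {L h : ℝ} (hδ : 0 < δ) (hL : 0 ≤ L)
    (hv : Continuous v) (hA : ∀ x, ‖v x‖ ≤ A) (hF : ∀ x, ‖F x‖ ≤ L * (‖v x‖ + h)) :
    ‖∫ x, weight δ x * inner ℝ (v x) (Complex.I * F x)‖ ≤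
      L / 2 * (3 * (∫ x, weight δ x * ‖v x‖ ^ 2) + h ^ 2 * (Real.pi / δ)) := by
  have iv : Integrable fun x => weight δ x * ‖v x‖ ^ 2 :=
    integrable_weight_mul_norm_sq hδ.ne' hv.aestronglyMeasurable (.of_forall hA)
  have ih : Integrable fun x => h ^ 2 * weight δ x := (integrable_weight hδ.ne').const_mul _
  have hbound : ∀ x, ‖weight δ x * inner ℝ (v x) (Complex.I * F x)‖ ≤
      L / 2 * (3 * (weight δ x * ‖v x‖ ^ 2) + h ^ 2 * weight δ x) := fun x => by
    have hw := weight_pos δ x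
    calc ‖weight δ x * inner ℝ (v x) (Complex.I * F x)‖
        ≤ weight δ x * (‖v x‖ * (L * (‖v x‖ + h))) := by
          rw [norm_mul, Real.norm_of_nonneg hw.le]
          gcongr
          exact norm_inner_I_mul_le_of_le le_rfl (hF x)
      _ = weight δ x * L * (‖v x‖ ^ 2 + ‖v x‖ * h) := by ring
      _ ≤ weight δ x * L * (‖v x‖ ^ 2 + (‖v x‖ ^ 2 + h ^ 2) / 2) := by
          gcongr
          linarith [two_mul_le_add_sq ‖v x‖ h]
      _ = L / 2 * (3 * (weight δ x * ‖v x‖ ^ 2) + h ^ 2 * weight δ x) := by ring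
  refine (norm_integral_le_of_norm_le (((iv.const_mul 3).add ih).const_mul _)
    (.of_forall hbound)).trans_eq ?_
  simp only [Pi.add_apply]
  rw [integral_const_mul, integral_add (iv.const_mul 3) ih, integral_const_mul, integral_const_mul,
    integral_weight hδ]

theorem norm_integral_weight_mul_inner_le {G : ℝ≥0} {L h : ℝ} (hδ : 0 < δ) (hL : 0 ≤ L)
    (hv : ∀ x, HasDerivAt v (v' x) x) (hv' : ∀ x, HasDerivAt v' (v'' x) x) (hc : Continuous v'')
    (hFc : Continuous F) (hA : ∀ x, ‖v x‖ ≤ A) (hB : ∀ x, ‖v' x‖ ≤ B) (hC : ∀ x, ‖v'' x‖ ≤ C)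
    (hG : eLpNorm v' 2 volume ≤ G) (hF : ∀ x, ‖F x‖ ≤ L * (‖v x‖ + h)) :
    ‖∫ x, weight δ x * (2 * inner ℝ (v x) (Complex.I * (v'' x - F x)))‖ ≤
      (3 * L + δ) * (∫ x, weight δ x * ‖v x‖ ^ 2) + (δ * G ^ 2 + L * h ^ 2 * (Real.pi / δ)) := by
  have hvc : Continuous v := continuous_iff_continuousAt.2 fun x => (hv x).continuousAt
  have hvc' : Continuous v' := continuous_iff_continuousAt.2 fun x => (hv' x).continuousAt
  have i1 : Integrable fun x => weight δ x * inner ℝ (v x) (Complex.I * v'' x) :=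
    integrable_weight_mul hδ.ne' (hvc.inner (continuous_const.mul hc)).aestronglyMeasurable
      (.of_forall fun x => norm_inner_I_mul_le_of_le (hA x) (hC x))
  have i2 : Integrable fun x => weight δ x * inner ℝ (v x) (Complex.I * F x) :=
    integrable_weight_mul hδ.ne' (hvc.inner (continuous_const.mul hFc)).aestronglyMeasurable
      (.of_forall fun x => norm_inner_I_mul_le_of_le (hA x) ((hF x).trans
        (mul_le_mul_of_nonneg_left (add_le_add_left (hA x) h) hL)))
  have hsplit : ∫ x, weight δ x * (2 * inner ℝ (v x) (Complex.I * (v'' x - F x))) =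
      2 * (-(∫ x, deriv (weight δ) x * inner ℝ (v x) (Complex.I * v' x)) -
        ∫ x, weight δ x * inner ℝ (v x) (Complex.I * F x)) := by
    rw [← integral_weight_mul_inner_I_mul_deriv_deriv hδ hv hv' hc hA hB hC, ← integral_sub i1 i2,
      ← integral_const_mul]
    refine integral_congr_ae (.of_forall fun x => ?_)
    simp only [mul_sub, inner_sub_right]
    ring
  rw [hsplit, norm_mul, Real.norm_two]
  refine (mul_le_mul_of_nonneg_left (norm_sub_le _ _) zero_le_two).trans ?_
  rw [norm_neg]
  linarith [norm_integral_deriv_weight_mul_inner_le hδ hvc hvc'.aestronglyMeasurable hA hG,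
    norm_integral_weight_mul_inner_forcing_le hδ hL hvc hA hF]

end EnergyEstimate

section Gronwall

variable {E : Type*} [NormedAddCommGroup E] [NormedSpace ℝ E] {f f' : ℝ → E} {K c t : ℝ}

theorem norm_le_of_norm_deriv_le_of_nonneg (hK : K ≠ 0) (ht : 0 ≤ t)
    (hf : ∀ s ∈ Set.Icc 0 t, HasDerivAt f (f' s) s) (hf0 : f 0 = 0)
    (hb : ∀ s ∈ Set.Icc 0 t, ‖f' s‖ ≤ K * ‖f s‖ + c) :
    ‖f t‖ ≤ c / K * (Real.exp (K * t) - 1) := by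
  have h := norm_le_gronwallBound_of_norm_deriv_right_le (δ := 0)
    (fun s hs => (hf s hs).continuousAt.continuousWithinAt)
    (fun s hs => (hf s (Set.Ico_subset_Icc_self hs)).hasDerivWithinAt)
    (by rw [hf0, norm_zero]) (fun s hs => hb s (Set.Ico_subset_Icc_self hs)) t ⟨ht, le_rfl⟩
  simpa only [gronwallBound_of_K_ne_0 hK, sub_zero, zero_mul, zero_add] using h

theorem norm_le_of_norm_deriv_le {I : Set ℝ} (hI : I.OrdConnected) (h0 : 0 ∈ I) (hK : K ≠ 0)
    (hf : ∀ s ∈ I, HasDerivAt f (f' s) s) (hf0 : f 0 = 0)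
    (hb : ∀ s ∈ I, ‖f' s‖ ≤ K * ‖f s‖ + c) (ht : t ∈ I) :
    ‖f t‖ ≤ c / K * (Real.exp (K * |t|) - 1) := by
  rcases le_total 0 t with htn | htn
  · rw [abs_of_nonneg htn]
    exact norm_le_of_norm_deriv_le_of_nonneg hK htn (fun s hs => hf s (hI.out h0 ht hs)) hf0
      fun s hs => hb s (hI.out h0 ht hs)
  · have hneg : ∀ s ∈ Set.Icc 0 (-t), -s ∈ I := fun s hs =>
      hI.out ht h0 ⟨le_neg_of_le_neg hs.2, neg_nonpos.2 hs.1⟩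
    rw [abs_of_nonpos htn, ← neg_neg t, neg_neg (-t)]
    refine norm_le_of_norm_deriv_le_of_nonneg (f := fun s => f (-s)) (f' := fun s => -f' (-s)) hK
      (neg_nonneg.2 htn) (fun s hs => ?_) (by rw [neg_zero, hf0]) fun s hs => ?_
    · simpa [Function.comp_def] using (hf (-s) (hneg s hs)).scomp s (hasDerivAt_neg s)
    · rw [norm_neg]
      exact hb _ (hneg s hs)

end Gronwall

section SchrodingerCurve

/-- The curve `w`, bounded in `L^∞ ∩ Ḣ¹`, solves `i ∂ₜ w + ∂ₓₓ w = f` on `I × ℝ`, with a forcing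
satisfying `|f| ≤ L |w|`. The equation is stated for the mollifications of `w`, for which it holds
classically. The differences of two solutions of (GP) are of this kind. -/
structure IsForcedSchrodingerCurve (I : Opens ℝ) (w f : ℝ → Wave) (M G L : ℝ≥0) : Prop where
  norm_le : ∀ t ∈ I, ∀ᵐ x, ‖w t x‖ ≤ M
  mollifiedDerivBound : ∀ t ∈ I, MollifiedDerivBound (w t) G
  norm_forcing_le : ∀ t ∈ I, ∀ᵐ x, ‖f t x‖ ≤ L * ‖w t x‖
  hasDerivAt_convolution : ∀ k : ℝ → ℝ, ContDiff ℝ ∞ k → HasCompactSupport k → ∀ x, ∀ t ∈ I,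
    HasDerivAt (fun s => (k ⋆ w s) x)
      (Complex.I * ((deriv (deriv k) ⋆ w t) x - (k ⋆ f t) x)) t

theorem locallyIntegrable_of_ae_norm_le {f : Wave} {C : ℝ} (h : ∀ᵐ x, ‖f x‖ ≤ C) :
    LocallyIntegrable f :=
  (memLp_top_of_bound (AEEqFun.aestronglyMeasurable f) C h).locallyIntegrable le_top

namespace IsForcedSchrodingerCurve

variable {I : Opens ℝ} {w f : ℝ → Wave} {M G L : ℝ≥0} {δ t : ℝ}

theorem locallyIntegrable (h : IsForcedSchrodingerCurve I w f M G L) (ht : t ∈ I) :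
    LocallyIntegrable (w t) :=
  locallyIntegrable_of_ae_norm_le (h.norm_le t ht)

theorem norm_forcing_le_mul (h : IsForcedSchrodingerCurve I w f M G L) (ht : t ∈ I) :
    ∀ᵐ x, ‖f t x‖ ≤ L * M := by
  filter_upwards [h.norm_le t ht, h.norm_forcing_le t ht] with x hx hfx
  exact hfx.trans (by gcongr)

theorem locallyIntegrable_forcing (h : IsForcedSchrodingerCurve I w f M G L) (ht : t ∈ I) :
    LocallyIntegrable (f t) :=
  locallyIntegrable_of_ae_norm_le (h.norm_forcing_le_mul ht)

theorem hasDerivAt_energy (h : IsForcedSchrodingerCurve I w f M G L) (hδ : δ ≠ 0) {k : ℝ → ℝ}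
    (hk : ContDiff ℝ ∞ k) (hkc : HasCompactSupport k) (ht : t ∈ I) :
    HasDerivAt (fun s => ∫ x, weight δ x * ‖(k ⋆ w s) x‖ ^ 2)
      (∫ x, weight δ x * (2 * inner ℝ ((k ⋆ w t) x)
        (Complex.I * ((deriv (deriv k) ⋆ w t) x - (k ⋆ f t) x)))) t := by
  have hk'' : Continuous (deriv (deriv k)) :=
    (contDiff_infty_iff_deriv.1 hk).2.continuous_deriv (by simp)
  have hki : Integrable k := hk.continuous.integrable_of_hasCompactSupport hkc
  have hki'' : Integrable (deriv (deriv k)) :=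
    hk''.integrable_of_hasCompactSupport hkc.deriv.deriv
  refine hasDerivAt_integral_weight_norm_sq I.isOpen hδ
    (V := fun s x => Complex.I * ((deriv (deriv k) ⋆ w s) x - (k ⋆ f s) x))
    (A := (∫ z, ‖k z‖) * M) (B := (∫ z, ‖deriv (deriv k) z‖) * M + (∫ z, ‖k z‖) * (L * M))
    (fun s hs x => h.hasDerivAt_convolution k hk hkc x s hs) (fun s hs => ?_) (fun s hs => ?_)
    (fun s hs => norm_convolution_le hki (h.norm_le s hs)) (fun s hs x => ?_) ht
  · exact hkc.continuous_convolution_left _ hk.continuous (h.locallyIntegrable hs)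
  · exact continuous_const.mul
      ((hkc.deriv.deriv.continuous_convolution_left _ hk'' (h.locallyIntegrable hs)).sub
        (hkc.continuous_convolution_left _ hk.continuous (h.locallyIntegrable_forcing hs)))
  · rw [norm_mul, Complex.norm_I, one_mul]
    exact (norm_sub_le _ _).trans (add_le_add (norm_convolution_le hki'' (h.norm_le s hs) x)
      (norm_convolution_le hki (h.norm_forcing_le_mul hs) x))

theorem norm_deriv_energy_le (h : IsForcedSchrodingerCurve I w f M G L) (hδ : 0 < δ)
    (φ : ContDiffBump (0 : ℝ)) (ht : t ∈ I) :
    ‖∫ x, weight δ x * (2 * inner ℝ ((φ.normed volume ⋆ w t) x)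
      (Complex.I * ((deriv (deriv (φ.normed volume)) ⋆ w t) x - (φ.normed volume ⋆ f t) x)))‖ ≤
      (3 * L + δ) * (∫ x, weight δ x * ‖(φ.normed volume ⋆ w t) x‖ ^ 2) +
        (δ * G ^ 2 + L * (2 * G * √φ.rOut) ^ 2 * (Real.pi / δ)) := by
  have hk : ContDiff ℝ ∞ (φ.normed volume) := φ.contDiff_normed
  have hkc := φ.hasCompactSupport_normed (μ := volume)
  have hk' : ContDiff ℝ ∞ (deriv (φ.normed volume)) := (contDiff_infty_iff_deriv.1 hk).2
  have hk'' : Continuous (deriv (deriv (φ.normed volume))) := hk'.continuous_deriv (by simp)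
  have hw := h.locallyIntegrable ht
  have hf := h.locallyIntegrable_forcing ht
  have hM := h.norm_le t ht
  exact norm_integral_weight_mul_inner_le hδ L.coe_nonneg
    (fun x => hkc.hasDerivAt_convolution_left _ (hk.of_le (by simp)) hw x)
    (fun x => hkc.deriv.hasDerivAt_convolution_left _ (hk'.of_le (by simp)) hw x)
    (hkc.deriv.deriv.continuous_convolution_left _ hk'' hw)
    (hkc.continuous_convolution_left _ hk.continuous hf)
    (norm_convolution_le φ.integrable_normed hM)
    (norm_convolution_le (hk'.continuous.integrable_of_hasCompactSupport hkc.deriv) hM)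
    (norm_convolution_le (hk''.integrable_of_hasCompactSupport hkc.deriv.deriv) hM)
    (h.mollifiedDerivBound t ht φ)
    ((h.mollifiedDerivBound t ht).norm_convolution_le_of_ae_norm_le hw hf L.coe_nonneg
      (h.norm_forcing_le t ht) φ)

theorem energy_le (h : IsForcedSchrodingerCurve I w f M G L) (hI : (I : Set ℝ).OrdConnected)
    (h0 : 0 ∈ I) (hw0 : w 0 = 0) (hδ : 0 < δ) (hδ1 : δ ≤ 1) {φ : ContDiffBump (0 : ℝ)}
    (hφ : φ.rOut = δ ^ 2) (ht : t ∈ I) :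
    ∫ x, weight δ x * ‖(φ.normed volume ⋆ w t) x‖ ^ 2 ≤
      δ * ((1 + 4 * Real.pi * L) * G ^ 2) / (3 * L + 1) * (Real.exp ((3 * L + 1) * |t|) - 1) := by
  have hinit : ∫ x, weight δ x * ‖(φ.normed volume ⋆ w 0) x‖ ^ 2 = 0 := by
    have hzero : ∀ᵐ x, ‖w 0 x‖ ≤ 0 := by
      rw [hw0]
      filter_upwards [AEEqFun.coeFn_zero (α := ℝ) (β := ℂ)] with x hx
      simp [hx]
    have hconv : ∀ x, (φ.normed volume ⋆ w 0) x = 0 := fun x => by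
      simpa using norm_convolution_le φ.integrable_normed hzero x
    simp [hconv]
  refine (Real.le_norm_self _).trans (norm_le_of_norm_deriv_le hI h0 (by positivity)
    (fun s hs => h.hasDerivAt_energy hδ.ne' φ.contDiff_normed φ.hasCompactSupport_normed hs) hinit
    (fun s hs => (h.norm_deriv_energy_le hδ φ hs).trans ?_) ht)
  have hE : 0 ≤ ∫ x, weight δ x * ‖(φ.normed volume ⋆ w s) x‖ ^ 2 :=
    integral_nonneg fun x => mul_nonneg (weight_pos δ x).le (sq_nonneg _)
  have herror : δ * G ^ 2 + L * (2 * G * √φ.rOut) ^ 2 * (Real.pi / δ) =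
      δ * ((1 + 4 * Real.pi * L) * G ^ 2) := by
    rw [hφ, Real.sqrt_sq hδ.le]
    field_simp
    ring
  rw [herror, Real.norm_of_nonneg hE]
  gcongr

theorem integral_weight_mul_norm_sq_le (h : IsForcedSchrodingerCurve I w f M G L) (hδ : 0 < δ)
    (φ : ContDiffBump (0 : ℝ)) (ht : t ∈ I) :
    ∫ x, weight δ x * ‖w t x‖ ^ 2 ≤ 2 * (∫ x, weight δ x * ‖(φ.normed volume ⋆ w t) x‖ ^ 2) +
      2 * G ^ 2 * φ.rOut * (Real.pi / δ) := by
  have hw := h.locallyIntegrable ht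
  have iw : Integrable fun x => weight δ x * ‖w t x‖ ^ 2 :=
    integrable_weight_mul_norm_sq hδ.ne' (AEEqFun.aestronglyMeasurable _) (h.norm_le t ht)
  have iv : Integrable fun x => weight δ x * ‖(φ.normed volume ⋆ w t) x‖ ^ 2 :=
    integrable_weight_mul_norm_sq hδ.ne' (φ.hasCompactSupport_normed.continuous_convolution_left _
      φ.continuous_normed hw).aestronglyMeasurable
      (.of_forall (norm_convolution_le φ.integrable_normed (h.norm_le t ht)))
  rw [← integral_weight hδ, ← integral_const_mul, ← integral_const_mul,
    ← integral_add (iv.const_mul 2) ((integrable_weight hδ.ne').const_mul _)]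
  refine integral_mono_ae iw ((iv.const_mul 2).add ((integrable_weight hδ.ne').const_mul _)) ?_
  filter_upwards [(h.mollifiedDerivBound t ht).ae_norm_convolution_sub_self_le hw φ] with x hx
  have htri : ‖w t x‖ ≤ ‖(φ.normed volume ⋆ w t) x‖ + G * √φ.rOut :=
    (norm_le_norm_add_norm_sub _ _).trans (by gcongr)
  calc weight δ x * ‖w t x‖ ^ 2
      ≤ weight δ x * (2 * (‖(φ.normed volume ⋆ w t) x‖ ^ 2 + (G * √φ.rOut) ^ 2)) := by
        have := (weight_pos δ x).le
        gcongr
        exact (pow_le_pow_left₀ (norm_nonneg _) htri 2).trans (add_sq_le)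
    _ = _ := by
        rw [mul_pow, Real.sq_sqrt φ.rOut_pos.le]
        ring

theorem eq_zero (h : IsForcedSchrodingerCurve I w f M G L) (hI : (I : Set ℝ).OrdConnected)
    (h0 : 0 ∈ I) (hw0 : w 0 = 0) (ht : t ∈ I) : w t = 0 := by
  set C : ℝ := 2 * ((1 + 4 * Real.pi * L) * G ^ 2 / (3 * L + 1) *
    (Real.exp ((3 * L + 1) * |t|) - 1)) + 2 * G ^ 2 * Real.pi with hC
  have hint : ∀ {δ : ℝ}, δ ≠ 0 → Integrable fun x => weight δ x * ‖w t x‖ ^ 2 := fun hδ =>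
    integrable_weight_mul_norm_sq hδ (AEEqFun.aestronglyMeasurable _) (h.norm_le t ht)
  have hsmall : ∀ δ ∈ Set.Ioc (0 : ℝ) 1, ∫ x, weight 1 x * ‖w t x‖ ^ 2 ≤ δ * C := by
    rintro δ ⟨hδ, hδ1⟩
    let φ : ContDiffBump (0 : ℝ) := ⟨δ ^ 2 / 2, δ ^ 2, by positivity, half_lt_self (by positivity)⟩
    have hφ : φ.rOut = δ ^ 2 := rfl
    calc ∫ x, weight 1 x * ‖w t x‖ ^ 2
        ≤ ∫ x, weight δ x * ‖w t x‖ ^ 2 :=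
          integral_mono (hint one_ne_zero) (hint hδ.ne') fun x =>
            mul_le_mul_of_nonneg_right (weight_anti hδ.le hδ1 x) (sq_nonneg _)
      _ ≤ _ := h.integral_weight_mul_norm_sq_le hδ φ ht
      _ ≤ _ := add_le_add_left (mul_le_mul_of_nonneg_left
          (h.energy_le hI h0 hw0 hδ hδ1 hφ ht) zero_le_two) _
      _ = δ * C := by
        rw [hφ, hC]
        field_simp
  have hzero : ∫ x, weight 1 x * ‖w t x‖ ^ 2 = 0 := by
    refine le_antisymm ?_ (integral_nonneg fun x => mul_nonneg (weight_pos 1 x).le (sq_nonneg _))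
    have hlim : Tendsto (fun δ : ℝ => δ * C) (𝓝[>] 0) (𝓝 0) := by
      simpa using (tendsto_id.mul_const C).mono_left (nhdsWithin_le_nhds (a := (0 : ℝ)))
    exact ge_of_tendsto hlim (mem_of_superset (Ioc_mem_nhdsGT one_pos) hsmall)
  have hae := (integral_eq_zero_iff_of_nonneg
    (fun x => mul_nonneg (weight_pos 1 x).le (sq_nonneg _)) (hint one_ne_zero)).1 hzero
  refine AEEqFun.ext ?_
  filter_upwards [hae, AEEqFun.coeFn_zero (α := ℝ) (β := ℂ)] with x hx hx0
  simpa [hx0, (weight_pos 1 x).ne'] using hx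

end IsForcedSchrodingerCurve

end SchrodingerCurve

section Difference

theorem convolution_coeFn_sub {f g : Wave} {k : ℝ → ℝ} (hk : Continuous k)
    (hkc : HasCompactSupport k) (hf : LocallyIntegrable f) (hg : LocallyIntegrable g) (x : ℝ) :
    (k ⋆ (f - g : Wave)) x = (k ⋆ f) x - (k ⋆ g) x := by
  rw [← convolution_sub hk hkc hf hg, convolution_congr _ ae_eq_rfl (AEEqFun.coeFn_sub f g)]
  rfl

theorem MollifiedDerivBound.sub {f g : Wave} {G₁ G₂ : ℝ≥0} (h₁ : MollifiedDerivBound f G₁)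
    (h₂ : MollifiedDerivBound g G₂) (hf : LocallyIntegrable f) (hg : LocallyIntegrable g) :
    MollifiedDerivBound (f - g : Wave) (G₁ + G₂) := fun φ => by
  have hk' : Continuous (deriv (φ.normed volume)) :=
    (φ.contDiff_normed (n := 1)).continuous_deriv le_rfl
  have hkc' := (φ.hasCompactSupport_normed (μ := volume)).deriv
  have hsub : deriv (φ.normed volume) ⋆ (f - g : Wave) =
      deriv (φ.normed volume) ⋆ f - deriv (φ.normed volume) ⋆ g :=
    funext (convolution_coeFn_sub hk' hkc' hf hg)
  rw [hsub, ENNReal.coe_add]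
  exact (eLpNorm_sub_le (hkc'.continuous_convolution_left _ hk' hf).aestronglyMeasurable
    (hkc'.continuous_convolution_left _ hk' hg).aestronglyMeasurable one_le_two).trans
    (add_le_add (h₁ φ) (h₂ φ))

variable {I : Opens ℝ} {q₁ q₂ : ℝ → Wave}

theorem IsDistributionalSolution.hasDerivAt_convolution_sub {M : ℝ≥0}
    (hs₁ : IsDistributionalSolution I q₁) (hs₂ : IsDistributionalSolution I q₂)
    (hI : (I : Set ℝ).OrdConnected) (hc₁ : ContinuousL2loc I q₁) (hc₂ : ContinuousL2loc I q₂)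
    (hM₁ : ∀ t ∈ I, ∀ᵐ x, ‖q₁ t x‖ ≤ M) (hM₂ : ∀ t ∈ I, ∀ᵐ x, ‖q₂ t x‖ ≤ M) {k : ℝ → ℝ}
    (hk : ContDiff ℝ ∞ k) (hkc : HasCompactSupport k) (x : ℝ) {t : ℝ} (ht : t ∈ I) :
    HasDerivAt (fun s => (k ⋆ (q₁ s - q₂ s : Wave)) x)
      (Complex.I * ((deriv (deriv k) ⋆ (q₁ t - q₂ t : Wave)) x -
        (k ⋆ ((q₁ t).comp nonlinearity continuous_nonlinearity -
          (q₂ t).comp nonlinearity continuous_nonlinearity : Wave)) x)) t := by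
  obtain ⟨L, hL⟩ := exists_lipschitzOnWith_nonlinearity M
  have hk'' : Continuous (deriv (deriv k)) :=
    (contDiff_infty_iff_deriv.1 hk).2.continuous_deriv (by simp)
  refine (((hs₁.hasDerivAt_convolution hI hc₁ hM₁ hk hkc x ht).sub
    (hs₂.hasDerivAt_convolution hI hc₂ hM₂ hk hkc x ht)).congr_of_eventuallyEq ?_).congr_deriv ?_
  · filter_upwards [I.isOpen.mem_nhds ht] with s hs
    exact convolution_coeFn_sub hk.continuous hkc (hc₁.locallyIntegrable hs)
      (hc₂.locallyIntegrable hs) x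
  · rw [convolution_coeFn_sub hk'' hkc.deriv.deriv (hc₁.locallyIntegrable ht)
      (hc₂.locallyIntegrable ht), convolution_coeFn_sub hk.continuous hkc
      ((hc₁.comp hM₁ continuous_nonlinearity hL).locallyIntegrable ht)
      ((hc₂.comp hM₂ continuous_nonlinearity hL).locallyIntegrable ht)]
    ring

theorem IsDistributionalSolution.exists_isForcedSchrodingerCurve_sub
    (hs₁ : IsDistributionalSolution I q₁) (hs₂ : IsDistributionalSolution I q₂)
    (hI : (I : Set ℝ).OrdConnected) (hc₁ : ContinuousL2loc I q₁) (hc₂ : ContinuousL2loc I q₂)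
    (hb₁ : BoundedLinftyHDotOne I q₁) (hb₂ : BoundedLinftyHDotOne I q₂) :
    ∃ M G L, IsForcedSchrodingerCurve I (fun t => q₁ t - q₂ t)
      (fun t => (q₁ t).comp nonlinearity continuous_nonlinearity -
        (q₂ t).comp nonlinearity continuous_nonlinearity) M G L := by
  obtain ⟨M₁, hM₁⟩ := hc₁.exists_forall_bound hb₁
  obtain ⟨M₂, hM₂⟩ := hc₂.exists_forall_bound hb₂
  obtain ⟨L, hL⟩ := exists_lipschitzOnWith_nonlinearity (max M₁ M₂ : ℝ≥0)
  have hmax₁ : ∀ t ∈ I, ∀ᵐ x, ‖q₁ t x‖ ≤ (max M₁ M₂ : ℝ≥0) := fun t ht =>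
    (hM₁ t ht).1.mono fun x hx => hx.trans (NNReal.coe_le_coe.2 (le_max_left _ _))
  have hmax₂ : ∀ t ∈ I, ∀ᵐ x, ‖q₂ t x‖ ≤ (max M₁ M₂ : ℝ≥0) := fun t ht =>
    (hM₂ t ht).1.mono fun x hx => hx.trans (NNReal.coe_le_coe.2 (le_max_right _ _))
  exact ⟨M₁ + M₂, M₁ + M₂, L,
    { norm_le := fun t ht => by
        filter_upwards [(hM₁ t ht).1, (hM₂ t ht).1, AEEqFun.coeFn_sub (q₁ t) (q₂ t)]
          with x hx₁ hx₂ hsub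
        rw [hsub]
        exact (norm_sub_le _ _).trans (add_le_add hx₁ hx₂)
      mollifiedDerivBound := fun t ht => (hM₁ t ht).2.sub (hM₂ t ht).2
        (hc₁.locallyIntegrable ht) (hc₂.locallyIntegrable ht)
      norm_forcing_le := fun t ht =>
        ae_norm_comp_sub_comp_le continuous_nonlinearity hL (hmax₁ t ht) (hmax₂ t ht)
      hasDerivAt_convolution := fun k hk hkc x t ht =>
        hs₁.hasDerivAt_convolution_sub hs₂ hI hc₁ hc₂ hmax₁ hmax₂ hk hkc x ht }⟩

end Difference

end GrossPitaevskii

theorem lemma3p1 (I : Opens ℝ) (hI : (I : Set ℝ).OrdConnected) (h0 : (0 : ℝ) ∈ I)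
    (q₀ : GrossPitaevskii.Wave) (hq₀ : GrossPitaevskii.MemLinftyHDotOne q₀)
    (q₁ q₂ : ℝ → GrossPitaevskii.Wave)
    (hc₁ : GrossPitaevskii.ContinuousL2loc I q₁) (hc₂ : GrossPitaevskii.ContinuousL2loc I q₂)
    (hb₁ : GrossPitaevskii.BoundedLinftyHDotOne I q₁)
    (hb₂ : GrossPitaevskii.BoundedLinftyHDotOne I q₂)
    (hs₁ : GrossPitaevskii.IsDistributionalSolution I q₁)
    (hs₂ : GrossPitaevskii.IsDistributionalSolution I q₂)
    (hi₁ : q₁ 0 = q₀) (hi₂ : q₂ 0 = q₀) :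
    ∀ t ∈ I, q₁ t = q₂ t := by
  obtain ⟨M, G, L, hdiff⟩ := hs₁.exists_isForcedSchrodingerCurve_sub hs₂ hI hc₁ hc₂ hb₁ hb₂
  intro t ht
  exact sub_eq_zero.1 (hdiff.eq_zero hI h0 (by rw [hi₁, hi₂, sub_self]) ht)
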